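/- **Setting.** All function spaces are over $\mathbb{R}_+=(0,\infty)$ with Lebesgue measure, with real or complex values. For $\alpha\ge -1/2$ and $\lambda,x>0$ let $\psi^{\alpha}_\lambda(x)=\sqrt{x\lambda}\,J_\alpha(x\lambda)$, where $J_\alpha$ is the Bessel function of the first kind, and let $\mathcal H_\alpha$ be the Hankel transform on $L^2(\mathbb R_+)$, $$\mathcal H_\alpha f(\lambda)=\int_0^\infty \psi^\alpha_\lambda(x)f(x)\,dx$$ (the integral being the $L^2$-limit of $\int_0^R$ as $R\to\infty$). The heat semigroup of the Bessel operator $-\frac{d^2}{dx^2}+\frac{1}{x^2}\left(\alpha^2-\frac14\right)$ (in the self-adjoint realization diagonalized by $\mathcal H_\alpha$) is $$T^{\alpha,\psi}_tf=\mathcal H_\alpha\big(e^{-t(\cdot)^2}\mathcal H_\alpha f\big),\qquad f\in L^2(\mathbb R_+),\ t\ge 0 .$$ It is extended to $L^1(\mathbb R_+)+L^\infty(\mathbb R_+)$ by $T^{\alpha,\psi}_0=\mathrm{Id}$ and, for $t>0$, $$T^{\alpha,\psi}_tf(x)=\int_0^\infty G_t^{\alpha,\psi}(x,y)f(y)\,dy,\qquad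 G^{\alpha,\psi}_t(x,y)=\int_0^\infty e^{-t\lambda^2}\psi^\alpha_\lambda(x)\psi^\alpha_\lambda(y)\,d\lambda .$$ A *symmetric diffusion semigroup* is a family $\{T_t\}_{t\ge0}$ of linear operators from $L^1+L^\infty$ to the measurable functions, $T_0=\mathrm{Id}$, such that (i) for each $1\le p\le\infty$ every $T_t$ is a contraction on $L^p$ and $\{T_t\}$ is a semigroup there; (ii) every $T_t$ is self-adjoint on $L^2$; (iii) $T_tf\to f$ in $L^2$ as $t\to0^+$ for each $f\in L^2$. It is *Markovian* if moreover $T_tf\ge 0$ whenever $f\ge0$, and $T_t\mathbf 1=\mathbf 1$ for all $t$; it is *submarkovian* if moreover $T_tf\ge0$ whenever $f\ge 0$, and $T_t\mathbf 1\le\mathbf 1$ for all $t$. A semigroup on $L^2$ is *$L^p$-contractive* if $\|T_tf\|_p\le\|f\|_p$ for all $1\le p\le\infty$, $t\ge0$ and $f\in L^2\cap L^p$. For $\gamma\ge\eta>0$ and $u>0$ put $H_{\eta,\gamma}(u)=\frac{\Gamma(\eta)}{\Gamma(\gamma)}u^{\gamma-\eta}e^{-u}\,{}_1F_1(\eta;\gamma;u)$,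 where ${}_1F_1$ is the confluent hypergeometric function. **Proposition.** Let $\alpha\in[-1/2,\infty)$. 1. For $t>0$ the integral defining $T^{\alpha,\psi}_tf(x)$ converges absolutely for every $f\in L^1+L^\infty$ and every $x>0$. For every $t\ge0$ and $f\in L^2$, the function $T^{\alpha,\psi}_tf$ so defined agrees almost everywhere with $\mathcal H_\alpha\big(e^{-t(\cdot)^2}\mathcal H_\alpha f\big)$. Moreover, for all $t,x>0$, $$T^{\alpha,\psi}_t\mathbf 1(x)=H_{\frac\alpha2+\frac34,\,\alpha+1}\Big(\frac{x^2}{4t}\Big).$$ 2. If $\alpha\in\{-1/2\}\cup[1/2,\infty)$, then $\{T^{\alpha,\psi}_t\}$ is a submarkovian symmetric diffusion semigroup, and it is Markovian if and only if $\alpha=-1/2$. 3. If $\alpha\in(-1/2,1/2)$, then $\{T^{\alpha,\psi}_t\}$ is not an $L^p$-contractive semigroup, but there is a constant $c=c(\alpha)>1$ such that for all $1\le p\le\infty$ and all $t>0$ the operator $T^{\alpha,\psi}_t$ maps $L^p$ into itself with $\|T^{\alpha,\psi}_t\|_{p\to p}\le c$. -/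

import Mathlib

open MeasureTheory Filter Topology Set
open scoped ENNReal ComplexOrder

noncomputable section

/-! ### Symmetric diffusion semigroups

Let `μ` be a measure on `X`.  Operators act on functions `X → 𝕜` (`𝕜 = ℝ` or `ℂ`), which are
identified when they agree `μ`-almost everywhere. -/

section Diffusion

variable {X 𝕜 : Type*} [MeasurableSpace X] [RCLike 𝕜]

/-- `f` belongs to `L¹(μ) + L^∞(μ)`. -/
def MemL1AddLinfty (μ : Measure X) (f : X → 𝕜) : Prop :=
  ∃ g h : X → 𝕜, MemLp g 1 μ ∧ MemLp h ∞ μ ∧ f = g + h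

/-- The family `T t`, `t ≥ 0`, is a symmetric diffusion semigroup on `(X, μ)`, with common domain
`L¹ + L^∞`. The first five fields say that each `T t` is a linear operator from `L¹ + L^∞` to the
space of (classes of) measurable functions, and that `T 0` is the identity. -/
structure IsSymmetricDiffusionSemigroup (μ : Measure X) (T : ℝ → (X → 𝕜) → (X → 𝕜)) : Prop where
  measurable : ∀ t, 0 ≤ t → ∀ f, MemL1AddLinfty μ f → AEStronglyMeasurable (T t f) μ
  congr : ∀ t, 0 ≤ t → ∀ f g, MemL1AddLinfty μ f → MemL1AddLinfty μ g →
    f =ᵐ[μ] g → T t f =ᵐ[μ] T t g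
  map_add : ∀ t, 0 ≤ t → ∀ f g, MemL1AddLinfty μ f → MemL1AddLinfty μ g →
    T t (f + g) =ᵐ[μ] T t f + T t g
  map_smul : ∀ t, 0 ≤ t → ∀ (a : 𝕜) (f), MemL1AddLinfty μ f → T t (a • f) =ᵐ[μ] a • T t f
  map_zero_time : ∀ f, MemL1AddLinfty μ f → T 0 f =ᵐ[μ] f
  /-- every `T t` is a contraction on every `L^p`, `1 ≤ p ≤ ∞` -/
  contraction : ∀ t, 0 ≤ t → ∀ p : ℝ≥0∞, 1 ≤ p → ∀ f, MemLp f p μ →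
    MemLp (T t f) p μ ∧ eLpNorm (T t f) p μ ≤ eLpNorm f p μ
  /-- the semigroup property on every `L^p`, `1 ≤ p ≤ ∞` -/
  semigroup : ∀ s t, 0 ≤ s → 0 ≤ t → ∀ p : ℝ≥0∞, 1 ≤ p → ∀ f, MemLp f p μ →
    T (s + t) f =ᵐ[μ] T s (T t f)
  /-- every `T t` is self-adjoint on `L²` -/
  self_adjoint : ∀ t, 0 ≤ t → ∀ f g, MemLp f 2 μ → MemLp g 2 μ →
    ∫ x, inner 𝕜 (T t f x) (g x) ∂μ = ∫ x, inner 𝕜 (f x) (T t g x) ∂μ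
  /-- strong continuity at `0` on `L²` -/
  tendsto_zero : ∀ f, MemLp f 2 μ →
    Tendsto (fun t => eLpNorm (T t f - f) 2 μ) (𝓝[>] 0) (𝓝 0)

/-- A Markovian semigroup: a symmetric diffusion semigroup that is positive and conservative. -/
structure IsMarkovianSemigroup (μ : Measure X) (T : ℝ → (X → 𝕜) → (X → 𝕜)) : Prop
    extends IsSymmetricDiffusionSemigroup μ T where
  positive : ∀ t, 0 ≤ t → ∀ f, MemL1AddLinfty μ f → (∀ᵐ x ∂μ, 0 ≤ f x) → ∀ᵐ x ∂μ, 0 ≤ T t f x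
  conservative : ∀ t, 0 ≤ t → ∀ᵐ x ∂μ, T t (fun _ => 1) x = 1

/-- A submarkovian semigroup: a positive symmetric diffusion semigroup with `T t 1 ≤ 1`. -/
structure IsSubmarkovianSemigroup (μ : Measure X) (T : ℝ → (X → 𝕜) → (X → 𝕜)) : Prop
    extends IsSymmetricDiffusionSemigroup μ T where
  positive : ∀ t, 0 ≤ t → ∀ f, MemL1AddLinfty μ f → (∀ᵐ x ∂μ, 0 ≤ f x) → ∀ᵐ x ∂μ, 0 ≤ T t f x
  subconservative : ∀ t, 0 ≤ t → ∀ᵐ x ∂μ, T t (fun _ => 1) x ≤ 1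

/-- A family of operators on `L²(μ)` is `L^p`-contractive if `‖T t f‖_p ≤ ‖f‖_p` for all
`1 ≤ p ≤ ∞`, all `t ≥ 0` and all `f ∈ L² ∩ L^p`. -/
def IsLpContractive (μ : Measure X) (T : ℝ → (X → 𝕜) → (X → 𝕜)) : Prop :=
  ∀ p : ℝ≥0∞, 1 ≤ p → ∀ t, 0 ≤ t → ∀ f, MemLp f 2 μ → MemLp f p μ →
    eLpNorm (T t f) p μ ≤ eLpNorm f p μ

end Diffusion

/-! ### Special functions -/

/-- The Bessel function of the first kind `J_ν(z)`, for `z > 0` and `ν > -1`. -/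
def besselJ (ν z : ℝ) : ℝ :=
  ∑' k : ℕ, (-1) ^ k / ((k.factorial : ℝ) * Real.Gamma (k + ν + 1)) * (z / 2) ^ (2 * (k : ℝ) + ν)

/-- The confluent hypergeometric function `₁F₁(a; b; z)`. -/
def confluentHypergeometric (a b z : ℝ) : ℝ :=
  ∑' k : ℕ, (ascPochhammer ℝ k).eval a / (ascPochhammer ℝ k).eval b * z ^ k / (k.factorial : ℝ)

/-- `H_{η,γ}(u) = Γ(η)/Γ(γ) u^{γ-η} e^{-u} ₁F₁(η; γ; u)`, for `u > 0` and `γ ≥ η > 0`. -/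
def auxH (η γ u : ℝ) : ℝ :=
  Real.Gamma η / Real.Gamma γ * u ^ (γ - η) * Real.exp (-u) * confluentHypergeometric η γ u

/-! ### The Hankel transform and the Bessel semigroup on `(0, ∞)` -/

/-- Lebesgue measure on `(0, ∞)`. -/
def halfLine : Measure ℝ := volume.restrict (Ioi 0)

/-- The eigenfunctions `ψ^α_l(x) = √(x l) J_α(x l)`. -/
def besselPsi (α l x : ℝ) : ℝ := Real.sqrt (x * l) * besselJ α (x * l)

section Bessel

variable {𝕜 : Type*} [RCLike 𝕜]

/-- `g` is the Hankel transform of order `α` of `f ∈ L²(0, ∞)`: the function `g` is in `L²(0, ∞)`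
and is the `L²`-limit, as `R → ∞`, of the functions `l ↦ ∫_0^R ψ^α_l(x) f(x) dx`. -/
def IsHankelTransform (α : ℝ) (f g : ℝ → 𝕜) : Prop :=
  MemLp g 2 halfLine ∧
    Tendsto (fun R : ℝ =>
      eLpNorm (fun l => g l - ∫ x in Ioo 0 R, besselPsi α l x • f x) 2 halfLine) atTop (𝓝 0)

/-- `h = exp(-t L) f` for `f ∈ L²(0, ∞)`, where `L` is the self-adjoint Bessel operator that the
Hankel transform `𝓗` diagonalizes: `h = 𝓗 (e^{-t l²} 𝓗 f)`. -/
def IsHankelHeat (α t : ℝ) (f h : ℝ → 𝕜) : Prop :=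
  ∃ g : ℝ → 𝕜, IsHankelTransform α f g ∧
    IsHankelTransform α (fun l => Real.exp (-t * l ^ 2) • g l) h

/-- The heat kernel `G_t(x, y) = ∫_0^∞ e^{-t l²} ψ^α_l(x) ψ^α_l(y) dl`. -/
def besselKernel (α t x y : ℝ) : ℝ :=
  ∫ l, Real.exp (-t * l ^ 2) * besselPsi α l x * besselPsi α l y ∂halfLine

/-- The Bessel semigroup as a family of integral operators:
`T_t f(x) = ∫_0^∞ G_t(x, y) f(y) dy` for `t > 0`, and `T_0 f = f`. -/
def besselSemigroup (α t : ℝ) (f : ℝ → 𝕜) : ℝ → 𝕜 :=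
  if t = 0 then f else fun x => ∫ y, besselKernel α t x y • f y ∂halfLine

end Bessel

end

/-!
By Weber's second exponential integral the heat kernel `G_t(x, y)` is a Gaussian times a modified
Bessel function with positive Taylor coefficients, hence positive. Integrating that Taylor series
term by term gives `∫ G_t(x, y) dy = auxH η (α + 1) (x² / 4t)` with `η = α / 2 + 3 / 4`. As the
kernel is also symmetric, Schur's test bounds all `L^p` norms by the supremum of this function,
while the `L¹` norm of the image of `f ≥ 0` is exactly the integral of `f` against it: contractivity
is thus decided by whether `auxH η (α + 1)` exceeds `1`.

Put `δ = α / 2 + 1 / 4`, so that `η + δ = α + 1`. For `δ > 0` Euler's integral for `₁F₁` reads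
`auxH η (η + δ) u = E[(1 - X) ^ (η - 1); X < 1]`, where `X` has the gamma distribution of shape `δ`
and rate `u`. This is less than `1` if `η ≥ 1` (that is, `α ≥ 1 / 2`); for `η < 1` it is bounded,
but the linear term of `(1 - X) ^ (η - 1)` makes it exceed `1` for large `u`. For `α = -1 / 2` one
has `δ = 0` and `auxH η η = 1`.

In `L²`, the functions `x ^ (α + 1 / 2) exp (-a x²)` are total by the Weierstrass theorem, and the
heat semigroup permutes them up to explicit factors, so strong continuity follows from uniform
boundedness. For `f` of bounded support, Fubini gives `⟨e^(-t l²) H f, H g⟩ = ⟨T_t f, g⟩`; as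
`t → 0⁺` this becomes the Plancherel identity, which extends the Hankel transform `H` to `L²` and
identifies `T_t` with `H e^(-t l²) H`.
-/

noncomputable section

/-! ### The Gamma function and binomial coefficients -/

lemma Gamma_add_natCast_eq_mul_ascPochhammer {a : ℝ} (ha : 0 < a) (n : ℕ) :
    Real.Gamma (a + n) = Real.Gamma a * (ascPochhammer ℝ n).eval a := by
  induction n with
  | zero => simp
  | succ n ih =>
    rw [Nat.cast_succ, ← add_assoc, Real.Gamma_add_one (by positivity), ih, ascPochhammer_succ_eval]
    ring

lemma ringChoose_eq_Gamma_div {a : ℝ} (ha : 0 < a) (n : ℕ) :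
    Ring.choose (a + n - 1) n = Real.Gamma (a + n) / (n.factorial * Real.Gamma a) := by
  have h := Ring.factorial_nsmul_multichoose_eq_ascPochhammer a n
  rw [Ring.multichoose_eq, Polynomial.ascPochhammer_smeval_eq_eval, nsmul_eq_mul] at h
  have := Real.Gamma_pos_of_pos ha
  rw [Gamma_add_natCast_eq_mul_ascPochhammer ha, ← h]
  field_simp

/-- The Chu–Vandermonde identity for `a + k + j - 1 = k + (a + j - 1)`. -/
lemma Gamma_add_add_div_eq_sum_antidiagonal {a : ℝ} (ha : 0 < a) (j k : ℕ) :
    Real.Gamma (a + k + j) / (j.factorial * Real.Gamma (a + k)) =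
      ∑ ij ∈ Finset.HasAntidiagonal.antidiagonal j, (k.choose ij.1 : ℝ) *
        (Real.Gamma (a + j) / (ij.2.factorial * Real.Gamma (a + ij.1))) := by
  rw [← ringChoose_eq_Gamma_div (by positivity), show a + k + j - 1 = k + (a + j - 1) by ring,
    Ring.add_choose_eq j (Commute.all _ _)]
  refine Finset.sum_congr rfl fun ij hij => ?_
  have hj : a + (j : ℝ) = a + ij.1 + ij.2 := by
    rw [← Finset.HasAntidiagonal.mem_antidiagonal.1 hij]; push_cast; ring
  rw [Ring.choose_natCast, hj, ringChoose_eq_Gamma_div (by positivity)]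

/-! ### The Bessel–Clifford function -/

/-- The Taylor coefficients of the Bessel–Clifford function `besselClifford α`. -/
def cliffordCoeff (α : ℝ) (k : ℕ) : ℝ := ((k.factorial : ℝ) * Real.Gamma (α + 1 + k))⁻¹

/-- The Bessel–Clifford function `∑ w ^ k / (k! Γ(α + 1 + k))` of order `α`. It is the entire part
of the Bessel functions: `J_α(z) = (z / 2) ^ α * besselClifford α (-z ^ 2 / 4)`, and the modified
Bessel function `I_α` is obtained at `z ^ 2 / 4`. -/
def besselClifford (α w : ℝ) : ℝ := ∑' k : ℕ, cliffordCoeff α k * w ^ k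

section Clifford

variable {α : ℝ}

lemma cliffordCoeff_pos (hα : -1 < α) (k : ℕ) : 0 < cliffordCoeff α k := by
  have ha : 0 < α + 1 := by linarith
  have := Real.Gamma_pos_of_pos (show 0 < α + 1 + k by positivity)
  unfold cliffordCoeff
  positivity

lemma cliffordCoeff_succ (hα : -1 < α) (k : ℕ) :
    cliffordCoeff α (k + 1) = cliffordCoeff α k / ((k + 1) * (α + 1 + k)) := by
  have ha : 0 < α + 1 := by linarith
  have h : 0 < α + 1 + k := by positivity
  have := Real.Gamma_pos_of_pos h
  rw [cliffordCoeff, Nat.cast_succ, ← add_assoc, Real.Gamma_add_one h.ne', cliffordCoeff,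
    Nat.factorial_succ]
  push_cast
  field_simp

lemma exists_cliffordCoeff_le (hα : -1 < α) :
    ∃ B, 0 ≤ B ∧ ∀ k, cliffordCoeff α k ≤ (Real.Gamma (α + 1))⁻¹ * (B ^ k / (2 * k).factorial) := by
  have ha : 0 < α + 1 := by linarith
  refine ⟨4 + 2 / (α + 1), by positivity, fun k => ?_⟩
  set B := 4 + 2 / (α + 1) with hB
  have := Real.Gamma_pos_of_pos ha
  induction k with
  | zero => simp [cliffordCoeff]
  | succ k ih =>
    have hfact : ((2 * (k + 1)).factorial : ℝ) =
        (2 * k).factorial * ((2 * k + 1) * (2 * k + 2)) := by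
      rw [show 2 * (k + 1) = 2 * k + 1 + 1 by ring, Nat.factorial_succ, Nat.factorial_succ]
      push_cast
      ring
    have hratio : 1 / ((k + 1) * (α + 1 + k)) ≤ B / ((2 * k + 1) * (2 * k + 2)) := by
      have hsub : B * (α + 1 + k) - (4 * k + 2) = 4 * (α + 1) + 2 * k / (α + 1) := by
        rw [hB]
        field_simp
        ring
      have : 4 * (k : ℝ) + 2 ≤ B * (α + 1 + k) := by
        rw [← sub_nonneg, hsub]
        positivity
      rw [div_le_div_iff₀ (by positivity) (by positivity)]
      nlinarith
    calc cliffordCoeff α (k + 1)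
        = cliffordCoeff α k * (1 / ((k + 1) * (α + 1 + k))) := by
          rw [cliffordCoeff_succ hα, mul_one_div]
      _ ≤ (Real.Gamma (α + 1))⁻¹ * (B ^ k / (2 * k).factorial) *
            (B / ((2 * k + 1) * (2 * k + 2))) := by
          gcongr
      _ = (Real.Gamma (α + 1))⁻¹ * (B ^ (k + 1) / (2 * (k + 1)).factorial) := by
          rw [hfact, pow_succ]
          field_simp

lemma exists_cliffordCoeff_mul_pow_le (hα : -1 < α) :
    ∃ B, ∀ w, 0 ≤ w → ∀ k, cliffordCoeff α k * w ^ k ≤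
      (Real.Gamma (α + 1))⁻¹ * ((B * √w) ^ (2 * k) / (2 * k).factorial) := by
  obtain ⟨B, hB, hle⟩ := exists_cliffordCoeff_le hα
  refine ⟨√B, fun w hw k => ?_⟩
  calc cliffordCoeff α k * w ^ k
      ≤ (Real.Gamma (α + 1))⁻¹ * (B ^ k / (2 * k).factorial) * w ^ k := by gcongr; exact hle k
    _ = _ := by
        rw [pow_mul, mul_pow, Real.sq_sqrt hB, Real.sq_sqrt hw, mul_pow]
        ring

lemma abs_cliffordCoeff_mul_pow (hα : -1 < α) (w : ℝ) (k : ℕ) :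
    |cliffordCoeff α k * w ^ k| = cliffordCoeff α k * |w| ^ k := by
  rw [abs_mul, abs_pow, abs_of_pos (cliffordCoeff_pos hα k)]

lemma summable_norm_cliffordCoeff_mul_pow (hα : -1 < α) (w : ℝ) :
    Summable fun k : ℕ => ‖cliffordCoeff α k * w ^ k‖ := by
  obtain ⟨B, hle⟩ := exists_cliffordCoeff_mul_pow_le hα
  simp_rw [Real.norm_eq_abs, abs_cliffordCoeff_mul_pow hα]
  exact Summable.of_nonneg_of_le
    (fun k => mul_nonneg (cliffordCoeff_pos hα k).le (by positivity))
    (hle |w| (abs_nonneg w)) ((Real.hasSum_cosh _).summable.mul_left _)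

lemma hasSum_besselClifford (hα : -1 < α) (w : ℝ) :
    HasSum (fun k : ℕ => cliffordCoeff α k * w ^ k) (besselClifford α w) :=
  (summable_norm_cliffordCoeff_mul_pow hα w).of_norm.hasSum

lemma besselClifford_nonneg (hα : -1 < α) {w : ℝ} (hw : 0 ≤ w) : 0 ≤ besselClifford α w :=
  tsum_nonneg fun k => mul_nonneg (cliffordCoeff_pos hα k).le (pow_nonneg hw k)

lemma abs_besselClifford_le (hα : -1 < α) (w : ℝ) :
    |besselClifford α w| ≤ besselClifford α |w| := by
  have h := norm_tsum_le_tsum_norm (summable_norm_cliffordCoeff_mul_pow hα w)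
  simp_rw [Real.norm_eq_abs, abs_cliffordCoeff_mul_pow hα] at h
  exact h

lemma exists_abs_besselClifford_le (hα : -1 < α) :
    ∃ B, ∀ w, |besselClifford α w| ≤ (Real.Gamma (α + 1))⁻¹ * Real.exp |B * √(|w|)| := by
  obtain ⟨B, hle⟩ := exists_cliffordCoeff_mul_pow_le hα
  refine ⟨B, fun w => (abs_besselClifford_le hα w).trans ?_⟩
  have hcosh := Real.hasSum_cosh (B * √(|w|))
  have hGamma := Real.Gamma_pos_of_pos (show 0 < α + 1 by linarith)
  calc besselClifford α |w|
      ≤ (Real.Gamma (α + 1))⁻¹ * Real.cosh (B * √(|w|)) :=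
        hasSum_le (hle |w| (abs_nonneg w)) (hasSum_besselClifford hα |w|) (hcosh.mul_left _)
    _ ≤ (Real.Gamma (α + 1))⁻¹ * Real.exp |B * √(|w|)| := by
        gcongr
        rw [← Real.cosh_abs, Real.cosh_eq]
        have := Real.exp_le_exp.2 (neg_le_self (abs_nonneg (B * √(|w|))))
        linarith

lemma continuous_besselClifford (hα : -1 < α) : Continuous (besselClifford α) := by
  rw [continuous_iff_continuousAt]
  intro w
  suffices h : ContinuousOn (besselClifford α) (Metric.closedBall 0 (|w| + 1)) from
    h.continuousAt (Metric.closedBall_mem_nhds_of_mem (by simp))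
  have hs := summable_norm_cliffordCoeff_mul_pow hα (|w| + 1)
  refine continuousOn_tsum (fun k => by fun_prop) hs fun k x hx => ?_
  have hx : |x| ≤ |w| + 1 := by simpa using hx
  have := (cliffordCoeff_pos hα k).le
  rw [Real.norm_eq_abs, Real.norm_eq_abs, abs_cliffordCoeff_mul_pow hα,
    abs_cliffordCoeff_mul_pow hα, abs_of_pos (by positivity : 0 < |w| + 1)]
  gcongr

lemma measurable_besselClifford (hα : -1 < α) : Measurable (besselClifford α) :=
  (continuous_besselClifford hα).measurable

end Clifford

/-! ### Gaussian integrals of functions of exponential growth -/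

/-- `f` has at most exponential growth on `(0, ∞)`. Such functions are integrable against Gaussians,
and Bessel functions are of this kind. -/
def HasExpGrowth (f : ℝ → ℝ) : Prop := ∃ C b, ∀ x, 0 < x → |f x| ≤ C * Real.exp (b * x)

namespace HasExpGrowth

variable {f g : ℝ → ℝ}

lemma one : HasExpGrowth fun _ => 1 := ⟨1, 0, fun x _ => by simp⟩

lemma mul (hf : HasExpGrowth f) (hg : HasExpGrowth g) : HasExpGrowth fun x => f x * g x := by
  obtain ⟨C, b, hf⟩ := hf
  obtain ⟨D, c, hg⟩ := hg
  refine ⟨C * D, b + c, fun x hx => ?_⟩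
  calc |f x * g x| = |f x| * |g x| := abs_mul _ _
    _ ≤ (C * Real.exp (b * x)) * (D * Real.exp (c * x)) :=
        mul_le_mul (hf x hx) (hg x hx) (abs_nonneg _) ((abs_nonneg _).trans (hf x hx))
    _ = C * D * Real.exp ((b + c) * x) := by rw [add_mul, Real.exp_add]; ring

lemma abs (hf : HasExpGrowth f) : HasExpGrowth fun x => |f x| := by
  simpa only [HasExpGrowth, abs_abs] using hf

lemma rpow {r : ℝ} (hr : 0 ≤ r) : HasExpGrowth fun x => x ^ r := by
  refine ⟨1, r, fun x hx => ?_⟩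
  rw [abs_of_pos (by positivity), one_mul, mul_comm, Real.exp_mul]
  exact Real.rpow_le_rpow hx.le (by linarith [Real.add_one_le_exp x]) hr

lemma besselClifford_mul_sq {α : ℝ} (hα : -1 < α) (w : ℝ) :
    HasExpGrowth fun x => besselClifford α (w * x ^ 2) := by
  obtain ⟨B, hB⟩ := exists_abs_besselClifford_le hα
  refine ⟨(Real.Gamma (α + 1))⁻¹, |B * √(|w|)|, fun x hx => (hB _).trans_eq ?_⟩
  rw [abs_mul w, Real.sqrt_mul (abs_nonneg w), abs_of_nonneg (sq_nonneg x), Real.sqrt_sq hx.le,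
    ← mul_assoc, abs_mul (_ * _), abs_of_pos hx]

lemma exists_exp_neg_mul_sq_mul_le (hf : HasExpGrowth f) {p : ℝ} (hp : 0 < p) :
    ∃ C, ∀ x, 0 < x → Real.exp (-p * x ^ 2) * |f x| ≤ C := by
  obtain ⟨C, b, hf⟩ := hf
  have hC : 0 ≤ C :=
    nonneg_of_mul_nonneg_left ((abs_nonneg _).trans (hf 1 one_pos)) (Real.exp_pos _)
  refine ⟨C * Real.exp (b ^ 2 / (4 * p)), fun x hx => ?_⟩
  have hsq : -p * x ^ 2 + b * x = b ^ 2 / (4 * p) - p * (x - b / (2 * p)) ^ 2 := by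
    field_simp
    ring
  calc Real.exp (-p * x ^ 2) * |f x|
      ≤ Real.exp (-p * x ^ 2) * (C * Real.exp (b * x)) := by gcongr; exact hf x hx
    _ = C * Real.exp (-p * x ^ 2 + b * x) := by rw [Real.exp_add]; ring
    _ ≤ C * Real.exp (b ^ 2 / (4 * p)) := by
        rw [hsq]
        gcongr
        exact sub_le_self _ (by positivity)

lemma integrableOn_gaussian_mul (hf : HasExpGrowth f) (hm : Measurable f) {p q : ℝ} (hp : 0 < p)
    (hq : -1 < q) : IntegrableOn (fun x => x ^ q * Real.exp (-p * x ^ 2) * f x) (Ioi 0) := by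
  obtain ⟨C, hC⟩ := hf.exists_exp_neg_mul_sq_mul_le (half_pos hp)
  refine Integrable.mono' ((integrableOn_rpow_mul_exp_neg_mul_sq (half_pos hp) hq).mul_const C)
    (by fun_prop) ?_
  filter_upwards [ae_restrict_mem measurableSet_Ioi] with x (hx : 0 < x)
  have hexp :
      Real.exp (-p * x ^ 2) = Real.exp (-(p / 2) * x ^ 2) * Real.exp (-(p / 2) * x ^ 2) := by
    rw [← Real.exp_add]; ring_nf
  rw [norm_mul, Real.norm_of_nonneg (by positivity), Real.norm_eq_abs, hexp, ← mul_assoc, mul_assoc]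
  gcongr
  exact hC x hx

end HasExpGrowth

lemma integral_rpow_mul_exp_neg_mul_sq {p q : ℝ} (hp : 0 < p) (hq : -1 < q) :
    ∫ x in Ioi (0 : ℝ), x ^ q * Real.exp (-p * x ^ 2) =
      p ^ (-((q + 1) / 2)) * Real.Gamma ((q + 1) / 2) / 2 := by
  have h := integral_rpow_mul_exp_neg_mul_rpow (p := 2) two_pos hq hp
  simp only [Real.rpow_two] at h
  rw [h, neg_div]
  ring

section TermwiseIntegration

variable {α : ℝ}

lemma hasSum_integral_gaussian_mul_mul_besselClifford (hα : -1 < α) {p q : ℝ} (hp : 0 < p)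
    (hq : -1 < q) {g : ℝ → ℝ} (hg : HasExpGrowth g) (hgm : Measurable g) (w : ℝ) :
    HasSum (fun k : ℕ => cliffordCoeff α k * w ^ k *
        ∫ x in Ioi (0 : ℝ), x ^ (q + 2 * k) * Real.exp (-p * x ^ 2) * g x)
      (∫ x in Ioi (0 : ℝ), x ^ q * Real.exp (-p * x ^ 2) *
        (g x * besselClifford α (w * x ^ 2))) := by
  have hΦ := measurable_besselClifford hα
  have hsum (v x : ℝ) := (hasSum_besselClifford hα (v * x ^ 2)).mul_left
  have hterm (k : ℕ) :
      ∫ x in Ioi (0 : ℝ), x ^ q * Real.exp (-p * x ^ 2) *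
        (g x * (cliffordCoeff α k * (w * x ^ 2) ^ k)) =
      cliffordCoeff α k * w ^ k *
        ∫ x in Ioi (0 : ℝ), x ^ (q + 2 * k) * Real.exp (-p * x ^ 2) * g x := by
    rw [← integral_const_mul]
    refine setIntegral_congr_fun measurableSet_Ioi fun x (hx : 0 < x) => ?_
    simp only [Real.rpow_add hx, mul_pow, ← pow_mul,
      show 2 * (k : ℝ) = ((2 * k : ℕ) : ℝ) by push_cast; ring, Real.rpow_natCast]
    ring
  simp_rw [← hterm]
  refine hasSum_integral_of_dominated_convergence
    (fun k x => x ^ q * Real.exp (-p * x ^ 2) * (|g x| * (cliffordCoeff α k * (|w| * x ^ 2) ^ k)))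
    (fun k => by fun_prop) (fun k => ?_) ?_ ?_ ?_
  · filter_upwards [ae_restrict_mem measurableSet_Ioi] with x (hx : 0 < x)
    rw [norm_mul, norm_mul (g x), Real.norm_of_nonneg (by positivity), Real.norm_eq_abs,
      Real.norm_eq_abs, abs_cliffordCoeff_mul_pow hα, abs_mul w, abs_of_nonneg (sq_nonneg x)]
  · exact Eventually.of_forall fun x => ((hsum |w| x _).mul_left _).summable
  · simp_rw [tsum_mul_left]
    exact (hg.abs.mul (.besselClifford_mul_sq hα |w|)).integrableOn_gaussian_mul
      (by fun_prop) hp hq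
  · exact Eventually.of_forall fun x => (hsum w x _).mul_left _

lemma hasSum_integral_gaussian_mul_besselClifford (hα : -1 < α) {p q : ℝ} (hp : 0 < p)
    (hq : -1 < q) (w : ℝ) :
    HasSum (fun k : ℕ => cliffordCoeff α k * w ^ k *
        (p ^ (-((q + 1) / 2 + k)) * Real.Gamma ((q + 1) / 2 + k) / 2))
      (∫ x in Ioi (0 : ℝ), x ^ q * Real.exp (-p * x ^ 2) * besselClifford α (w * x ^ 2)) := by
  have h := hasSum_integral_gaussian_mul_mul_besselClifford hα hp hq .one measurable_const w
  simp only [one_mul, mul_one] at h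
  convert! h using 3 with k
  have : (0 : ℝ) ≤ k := k.cast_nonneg
  rw [integral_rpow_mul_exp_neg_mul_sq hp (by linarith),
    show (q + 2 * k + 1) / 2 = (q + 1) / 2 + k by ring]

end TermwiseIntegration

/-! ### Weber's second exponential integral -/

/-- The polynomial `∑ m ≤ k, choose k m * Γ(α + 1 + k) / Γ(α + 1 + m) * X ^ m`, which is
`k! L_k^α(-X)` in terms of the Laguerre polynomial `L_k^α`. It carries the Gaussian moments of the
Bessel–Clifford function. -/
def laguerreNeg (α : ℝ) (k : ℕ) (X : ℝ) : ℝ :=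
  ∑ m ∈ Finset.range (k + 1),
    (k.choose m * (Real.Gamma (α + 1 + k) / Real.Gamma (α + 1 + m))) * X ^ m

section Weber

variable {α : ℝ}

lemma Gamma_mul_cliffordCoeff_eq_sum_antidiagonal (hα : -1 < α) (j k : ℕ) :
    Real.Gamma (α + 1 + k + j) * cliffordCoeff α j =
      ∑ ij ∈ Finset.HasAntidiagonal.antidiagonal j,
        (k.choose ij.1 * (Real.Gamma (α + 1 + k) / Real.Gamma (α + 1 + ij.1))) *
          (ij.2.factorial : ℝ)⁻¹ := by
  have ha : 0 < α + 1 := by linarith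
  have hGamma (m : ℕ) := Real.Gamma_pos_of_pos (show 0 < α + 1 + m by positivity)
  have := hGamma j
  have := hGamma k
  calc Real.Gamma (α + 1 + k + j) * cliffordCoeff α j
      = Real.Gamma (α + 1 + k + j) / (j.factorial * Real.Gamma (α + 1 + k)) *
          (Real.Gamma (α + 1 + k) / Real.Gamma (α + 1 + j)) := by
        rw [cliffordCoeff]
        field_simp
    _ = _ := by
        rw [Gamma_add_add_div_eq_sum_antidiagonal ha, Finset.sum_mul]
        refine Finset.sum_congr rfl fun ij _ => ?_
        field_simp

lemma tsum_Gamma_mul_cliffordCoeff_mul_pow (hα : -1 < α) (k : ℕ) (X : ℝ) :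
    ∑' j : ℕ, Real.Gamma (α + 1 + k + j) * cliffordCoeff α j * X ^ j =
      Real.exp X * laguerreNeg α k X := by
  let c (m : ℕ) : ℝ := (k.choose m * (Real.Gamma (α + 1 + k) / Real.Gamma (α + 1 + m))) * X ^ m
  have hc : ∀ m ∉ Finset.range (k + 1), c m = 0 := fun m hm => by
    simp [c, Nat.choose_eq_zero_of_lt (show k < m by simpa using hm)]
  have hsum : Summable fun m => ‖c m‖ :=
    (hasSum_sum_of_ne_finset_zero fun m hm => by rw [hc m hm, norm_zero]).summable
  rw [laguerreNeg, ← tsum_eq_sum (L := .unconditional ℕ) hc, Real.exp_eq_exp_ℝ,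
    NormedSpace.exp_eq_tsum_div, mul_comm,
    tsum_mul_tsum_eq_tsum_sum_antidiagonal_of_summable_norm hsum
      (NormedSpace.norm_expSeries_div_summable X)]
  refine tsum_congr fun j => ?_
  rw [Gamma_mul_cliffordCoeff_eq_sum_antidiagonal hα, Finset.sum_mul]
  refine Finset.sum_congr rfl fun ij hij => ?_
  simp only [c, ← Finset.HasAntidiagonal.mem_antidiagonal.1 hij, pow_add]
  ring

lemma tsum_cliffordCoeff_mul_pow_mul_laguerreNeg (hα : -1 < α) (X Y : ℝ) :
    ∑' k : ℕ, cliffordCoeff α k * Y ^ k * laguerreNeg α k X =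
      Real.exp Y * besselClifford α (X * Y) := by
  rw [Real.exp_eq_exp_ℝ, NormedSpace.exp_eq_tsum_div, mul_comm, besselClifford,
    tsum_mul_tsum_eq_tsum_sum_antidiagonal_of_summable_norm
      (summable_norm_cliffordCoeff_mul_pow hα _) (NormedSpace.norm_expSeries_div_summable Y)]
  refine tsum_congr fun k => ?_
  rw [laguerreNeg, ← Finset.Nat.sum_antidiagonal_eq_sum_range_succ_mk (n := k) (f := fun ij =>
    (k.choose ij.1 * (Real.Gamma (α + 1 + k) / Real.Gamma (α + 1 + ij.1))) * X ^ ij.1),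
    Finset.mul_sum]
  refine Finset.sum_congr rfl ?_
  rintro ⟨m, n⟩ hmn
  obtain rfl : m + n = k := Finset.HasAntidiagonal.mem_antidiagonal.1 hmn
  have ha : 0 < α + 1 := by linarith
  have := Real.Gamma_pos_of_pos (show 0 < α + 1 + (m + n : ℕ) by positivity)
  have hchoose : ((m + n).choose m : ℝ) = (m + n).factorial / (m.factorial * n.factorial) := by
    rw [Nat.cast_add_choose]
  simp only [cliffordCoeff, hchoose, pow_add, mul_pow]
  field_simp

lemma integral_rpow_mul_gaussian_mul_besselClifford (hα : -1 < α) {p : ℝ} (hp : 0 < p) (A : ℝ)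
    (k : ℕ) :
    ∫ x in Ioi (0 : ℝ), x ^ (2 * α + 1 + 2 * k) * Real.exp (-p * x ^ 2) *
        besselClifford α (A * x ^ 2) =
      p ^ (-(α + 1)) / 2 * Real.exp (A / p) * (laguerreNeg α k (A / p) / p ^ k) := by
  have hq : -1 < 2 * α + 1 + 2 * k := by linarith [k.cast_nonneg (α := ℝ)]
  have hterm (j : ℕ) : cliffordCoeff α j * A ^ j *
      (p ^ (-((2 * α + 1 + 2 * k + 1) / 2 + j)) *
        Real.Gamma ((2 * α + 1 + 2 * k + 1) / 2 + j) / 2) =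
      p ^ (-(α + 1)) / 2 / p ^ k *
        (Real.Gamma (α + 1 + k + j) * cliffordCoeff α j * (A / p) ^ j) := by
    rw [show (2 * α + 1 + 2 * k + 1) / 2 = α + 1 + k by ring,
      show -(α + 1 + k + j) = -(α + 1) - (k + j : ℕ) by push_cast; ring, Real.rpow_sub hp,
      Real.rpow_natCast, pow_add, div_pow]
    field_simp
  rw [← (hasSum_integral_gaussian_mul_besselClifford hα hp hq A).tsum_eq]
  simp_rw [hterm]
  rw [tsum_mul_left, tsum_Gamma_mul_cliffordCoeff_mul_pow hα]
  ring

theorem integral_gaussian_mul_besselClifford_mul_besselClifford (hα : -1 < α) {p : ℝ} (hp : 0 < p)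
    (A B : ℝ) :
    ∫ x in Ioi (0 : ℝ), x ^ (2 * α + 1) * Real.exp (-p * x ^ 2) *
        (besselClifford α (A * x ^ 2) * besselClifford α (B * x ^ 2)) =
      p ^ (-(α + 1)) / 2 * Real.exp ((A + B) / p) * besselClifford α (A * B / p ^ 2) := by
  have hΦ := measurable_besselClifford hα
  have h := hasSum_integral_gaussian_mul_mul_besselClifford hα hp (by linarith)
    (.besselClifford_mul_sq hα A) (by fun_prop) B (q := 2 * α + 1)
  have hterm (k : ℕ) : cliffordCoeff α k * B ^ k *
      (p ^ (-(α + 1)) / 2 * Real.exp (A / p) * (laguerreNeg α k (A / p) / p ^ k)) =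
      p ^ (-(α + 1)) / 2 * Real.exp (A / p) *
        (cliffordCoeff α k * (B / p) ^ k * laguerreNeg α k (A / p)) := by
    rw [div_pow]
    ring
  rw [← h.tsum_eq]
  simp_rw [integral_rpow_mul_gaussian_mul_besselClifford hα hp A, hterm]
  rw [tsum_mul_left, tsum_cliffordCoeff_mul_pow_mul_laguerreNeg hα, add_div, Real.exp_add,
    div_mul_div_comm, ← sq]
  ring

end Weber

/-! ### The heat kernel -/

/-- The eigenfunction `√z J_α(z)`, extended to an even function of `z : ℝ`. -/
def besselEven (α z : ℝ) : ℝ := 2 ^ (-α) * |z| ^ (α + 1 / 2) * besselClifford α (-1 / 4 * z ^ 2)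

/-- The closed form of the heat kernel, extended to an even function of both variables. -/
def besselHeatKernel (α t x y : ℝ) : ℝ :=
  2 * (4 * t)⁻¹ ^ (α + 1) * |x * y| ^ (α + 1 / 2) * Real.exp (-(4 * t)⁻¹ * (x ^ 2 + y ^ 2)) *
    besselClifford α (((4 * t)⁻¹ * x * y) ^ 2)

section Kernel

variable {α s t x y z : ℝ}

lemma besselJ_eq_rpow_mul_besselClifford (hz : 0 < z) :
    besselJ α z = (z / 2) ^ α * besselClifford α (-1 / 4 * z ^ 2) := by
  rw [besselJ, besselClifford, ← tsum_mul_left]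
  refine tsum_congr fun k => ?_
  rw [Real.rpow_add (by positivity), show 2 * (k : ℝ) = ((2 * k : ℕ) : ℝ) by push_cast; ring,
    Real.rpow_natCast, cliffordCoeff, show -1 / 4 * z ^ 2 = -1 * (z / 2) ^ 2 by ring, mul_pow,
    ← pow_mul, show k + α + 1 = α + 1 + k by ring]
  ring

lemma besselPsi_eq_besselEven (hx : 0 < x) (hy : 0 < y) :
    besselPsi α x y = besselEven α (x * y) := by
  have hxy : 0 < y * x := by positivity
  rw [besselPsi, besselJ_eq_rpow_mul_besselClifford hxy, besselEven, mul_comm x y, abs_of_pos hxy,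
    Real.sqrt_eq_rpow, Real.div_rpow hxy.le two_pos.le, Real.rpow_add hxy, Real.rpow_neg two_pos.le]
  ring

lemma continuous_besselEven (hα : -1 / 2 ≤ α) : Continuous (besselEven α) := by
  have hΦ := continuous_besselClifford (show -1 < α by linarith)
  have hpow : Continuous fun z : ℝ => |z| ^ (α + 1 / 2) :=
    continuous_abs.rpow_const fun z => Or.inr (by linarith)
  unfold besselEven
  fun_prop

lemma besselHeatKernel_nonneg (hα : -1 < α) (ht : 0 < t) (x y : ℝ) :
    0 ≤ besselHeatKernel α t x y := by
  have := besselClifford_nonneg hα (sq_nonneg ((4 * t)⁻¹ * x * y))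
  unfold besselHeatKernel
  positivity

lemma besselHeatKernel_comm (α t x y : ℝ) :
    besselHeatKernel α t x y = besselHeatKernel α t y x := by
  rw [besselHeatKernel, besselHeatKernel, mul_comm x y, add_comm (x ^ 2),
    mul_right_comm (4 * t)⁻¹]

lemma measurable_besselHeatKernel (hα : -1 < α) (t : ℝ) :
    Measurable (Function.uncurry (besselHeatKernel α t)) := by
  have := measurable_besselClifford hα
  unfold besselHeatKernel Function.uncurry
  fun_prop

lemma besselHeatKernel_eq (hx : 0 < x) (hy : 0 < y) :
    besselHeatKernel α t x y =
      2 * (4 * t)⁻¹ ^ (α + 1) * x ^ (α + 1 / 2) * Real.exp (-(4 * t)⁻¹ * x ^ 2) *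
        (y ^ (α + 1 / 2) * Real.exp (-(4 * t)⁻¹ * y ^ 2) *
          besselClifford α (((4 * t)⁻¹ * x) ^ 2 * y ^ 2)) := by
  rw [besselHeatKernel, abs_of_pos (by positivity), Real.mul_rpow hx.le hy.le, mul_add,
    Real.exp_add, mul_pow _ y]
  ring

lemma besselPsi_mul_besselPsi_eq (hx : 0 < x) (hy : 0 < y) {l : ℝ} (hl : 0 < l) :
    besselPsi α l x * besselPsi α l y = 4 ^ (-α) * (x * y) ^ (α + 1 / 2) * (l ^ (2 * α + 1) *
      (besselClifford α (-1 / 4 * x ^ 2 * l ^ 2) * besselClifford α (-1 / 4 * y ^ 2 * l ^ 2))) := by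
  rw [besselPsi_eq_besselEven hl hx, besselPsi_eq_besselEven hl hy, besselEven, besselEven,
    abs_of_pos (by positivity), abs_of_pos (by positivity), Real.mul_rpow hl.le hx.le,
    Real.mul_rpow hl.le hy.le, Real.mul_rpow hx.le hy.le, show (4 : ℝ) = 2 * 2 by norm_num,
    Real.mul_rpow two_pos.le two_pos.le, show 2 * α + 1 = α + 1 / 2 + (α + 1 / 2) by ring,
    Real.rpow_add hl (α + 1 / 2) (α + 1 / 2), mul_pow, mul_pow, mul_comm (l ^ 2), mul_comm (l ^ 2)]
  simp only [← mul_assoc]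
  ring

lemma besselKernel_eq (hα : -1 < α) (ht : 0 < t) (hx : 0 < x) (hy : 0 < y) :
    besselKernel α t x y = besselHeatKernel α t x y := by
  have hxy : 0 < x * y := by positivity
  calc besselKernel α t x y
      = 4 ^ (-α) * (x * y) ^ (α + 1 / 2) *
          ∫ l in Ioi (0 : ℝ), l ^ (2 * α + 1) * Real.exp (-t * l ^ 2) *
            (besselClifford α (-1 / 4 * x ^ 2 * l ^ 2) *
              besselClifford α (-1 / 4 * y ^ 2 * l ^ 2)) := by
        rw [besselKernel, ← integral_const_mul]
        refine setIntegral_congr_fun measurableSet_Ioi fun l hl => ?_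
        simp only [mul_assoc (Real.exp _), besselPsi_mul_besselPsi_eq hx hy hl]
        ring
    _ = besselHeatKernel α t x y := by
        rw [integral_gaussian_mul_besselClifford_mul_besselClifford hα ht, besselHeatKernel,
          abs_of_pos hxy, mul_inv 4 t, Real.mul_rpow (x := 4⁻¹) (by norm_num) (by positivity),
          Real.inv_rpow zero_le_four, Real.inv_rpow ht.le, ← Real.rpow_neg zero_le_four,
          ← Real.rpow_neg ht.le, neg_add α, Real.rpow_add zero_lt_four, Real.rpow_neg_one,
          show (-1 / 4 * x ^ 2 + -1 / 4 * y ^ 2) / t = -(4⁻¹ * t⁻¹) * (x ^ 2 + y ^ 2) by ring,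
          show -1 / 4 * x ^ 2 * (-1 / 4 * y ^ 2) / t ^ 2 = (4⁻¹ * t⁻¹ * x * y) ^ 2 by ring]
        ring

/-- The Chapman–Kolmogorov identity. -/
lemma integral_besselHeatKernel_mul_besselHeatKernel (hα : -1 < α) (hs : 0 < s) (ht : 0 < t)
    (hx : 0 < x) (hz : 0 < z) :
    ∫ y in Ioi (0 : ℝ), besselHeatKernel α s x y * besselHeatKernel α t y z =
      besselHeatKernel α (s + t) x z := by
  set p := (4 * s)⁻¹ with hp_def
  set q := (4 * t)⁻¹ with hq_def
  have hp : 0 < p := by positivity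
  have hq : 0 < q := by positivity
  have hr : (4 * (s + t))⁻¹ = p * q / (p + q) := by
    rw [hp_def, hq_def]
    field_simp
    ring
  calc ∫ y in Ioi (0 : ℝ), besselHeatKernel α s x y * besselHeatKernel α t y z
      = 4 * (p * q) ^ (α + 1) * (x * z) ^ (α + 1 / 2) *
          Real.exp (-(p * x ^ 2 + q * z ^ 2)) *
        ∫ y in Ioi (0 : ℝ), y ^ (2 * α + 1) * Real.exp (-(p + q) * y ^ 2) *
          (besselClifford α ((p * x) ^ 2 * y ^ 2) * besselClifford α ((q * z) ^ 2 * y ^ 2)) := by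
        rw [← integral_const_mul]
        refine setIntegral_congr_fun measurableSet_Ioi fun y (hy : 0 < y) => ?_
        simp only [besselHeatKernel_comm α t y z]
        rw [besselHeatKernel_eq hx hy, besselHeatKernel_eq hz hy, ← hp_def, ← hq_def,
          Real.mul_rpow hp.le hq.le, Real.mul_rpow hx.le hz.le,
          show 2 * α + 1 = α + 1 / 2 + (α + 1 / 2) by ring,
          Real.rpow_add hy (α + 1 / 2) (α + 1 / 2),
          show -(p * x ^ 2 + q * z ^ 2) = -p * x ^ 2 + -q * z ^ 2 by ring, Real.exp_add,
          show -(p + q) * y ^ 2 = -p * y ^ 2 + -q * y ^ 2 by ring, Real.exp_add]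
        ring
    _ = besselHeatKernel α (s + t) x z := by
        have hexp : -(p * q / (p + q)) * (x ^ 2 + z ^ 2) =
            -(p * x ^ 2 + q * z ^ 2) + ((p * x) ^ 2 + (q * z) ^ 2) / (p + q) := by
          field_simp
          ring
        rw [integral_gaussian_mul_besselClifford_mul_besselClifford hα (add_pos hp hq),
          besselHeatKernel, hr, hexp, Real.exp_add, abs_of_pos (mul_pos hx hz),
          Real.div_rpow (by positivity) (by positivity), Real.rpow_neg (by positivity),
          show (p * x) ^ 2 * (q * z) ^ 2 / (p + q) ^ 2 = (p * q / (p + q) * x * z) ^ 2 by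
            field_simp]
        ring

lemma integrableOn_besselHeatKernel (hα : -1 < α) (ht : 0 < t) (hx : 0 < x) :
    IntegrableOn (besselHeatKernel α t x) (Ioi 0) := by
  have := measurable_besselClifford hα
  refine IntegrableOn.congr_fun ?_ (fun y hy => (besselHeatKernel_eq hx hy).symm) measurableSet_Ioi
  exact (HasExpGrowth.besselClifford_mul_sq hα _).integrableOn_gaussian_mul (by fun_prop)
    (by positivity) (by linarith) |>.const_mul _

lemma exists_besselHeatKernel_le (hα : -1 / 2 ≤ α) (ht : 0 < t) (hx : 0 < x) :
    ∃ C, ∀ y, 0 < y → besselHeatKernel α t x y ≤ C := by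
  have hgrowth := (HasExpGrowth.rpow (show 0 ≤ α + 1 / 2 by linarith)).mul
    (.besselClifford_mul_sq (show -1 < α by linarith) (((4 * t)⁻¹ * x) ^ 2))
  obtain ⟨C, hC⟩ := hgrowth.exists_exp_neg_mul_sq_mul_le (show 0 < (4 * t)⁻¹ by positivity)
  refine ⟨2 * (4 * t)⁻¹ ^ (α + 1) * x ^ (α + 1 / 2) * Real.exp (-(4 * t)⁻¹ * x ^ 2) * C,
    fun y hy => ?_⟩
  rw [besselHeatKernel_eq hx hy]
  gcongr
  refine le_trans ?_ (hC y hy)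
  rw [mul_comm (y ^ _), mul_assoc]
  gcongr
  exact le_abs_self _

/-! ### The action of the heat kernel on constants -/

lemma auxH_eq_tsum {η γ : ℝ} (hη : 0 < η) (hγ : 0 < γ) (u : ℝ) :
    auxH η γ u = u ^ (γ - η) * Real.exp (-u) *
      ∑' k : ℕ, Real.Gamma (η + k) / (Real.Gamma (γ + k) * k.factorial) * u ^ k := by
  have hterm (k : ℕ) : Real.Gamma (η + k) / (Real.Gamma (γ + k) * k.factorial) * u ^ k =
      Real.Gamma η / Real.Gamma γ * ((ascPochhammer ℝ k).eval η / (ascPochhammer ℝ k).eval γ *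
        u ^ k / (k.factorial : ℝ)) := by
    rw [Gamma_add_natCast_eq_mul_ascPochhammer hη, Gamma_add_natCast_eq_mul_ascPochhammer hγ]
    simp only [div_eq_mul_inv, mul_inv]
    ring
  simp_rw [hterm]
  rw [tsum_mul_left, auxH, confluentHypergeometric]
  ring

lemma integral_besselHeatKernel (hα : -1 < α) (ht : 0 < t) (hx : 0 < x) :
    ∫ y in Ioi (0 : ℝ), besselHeatKernel α t x y =
      auxH (α / 2 + 3 / 4) (α + 1) (x ^ 2 / (4 * t)) := by
  set p := (4 * t)⁻¹ with hp_def
  have hp : 0 < p := by positivity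
  have hterm (k : ℕ) : cliffordCoeff α k * ((p * x) ^ 2) ^ k *
      (p ^ (-((α + 1 / 2 + 1) / 2 + k)) * Real.Gamma ((α + 1 / 2 + 1) / 2 + k) / 2) =
      p ^ (-(α / 2 + 3 / 4)) / 2 * (Real.Gamma (α / 2 + 3 / 4 + k) /
        (Real.Gamma (α + 1 + k) * k.factorial) * (x ^ 2 * p) ^ k) := by
    rw [show (α + 1 / 2 + 1) / 2 = α / 2 + 3 / 4 by ring, neg_add, Real.rpow_add hp,
      Real.rpow_neg hp.le k, Real.rpow_natCast, cliffordCoeff,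
      show (p * x) ^ 2 = x ^ 2 * p * p by ring, mul_pow]
    field_simp
  have hpow : p ^ (α + 1) * x ^ (α + 1 / 2) * p ^ (-(α / 2 + 3 / 4)) =
      (x ^ 2 * p) ^ (α + 1 - (α / 2 + 3 / 4)) := by
    rw [Real.mul_rpow (by positivity) hp.le, ← Real.rpow_natCast, ← Real.rpow_mul hx.le,
      mul_right_comm, ← Real.rpow_add hp, mul_comm]
    congr 2
    push_cast
    ring
  rw [setIntegral_congr_fun measurableSet_Ioi fun y hy => besselHeatKernel_eq hx hy,
    integral_const_mul,
    ← (hasSum_integral_gaussian_mul_besselClifford hα hp (by linarith) _).tsum_eq,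
    div_eq_mul_inv (x ^ 2), ← hp_def, auxH_eq_tsum (by linarith) (by linarith), ← hpow]
  simp_rw [hterm]
  rw [tsum_mul_left, neg_mul, mul_comm p]
  ring

end Kernel

/-! ### Moments of the beta and gamma distributions -/

section BetaGamma

open ProbabilityTheory

variable {a b r : ℝ}

lemma measurable_betaPDF (a b : ℝ) : Measurable (betaPDF a b) :=
  (measurable_betaPDFReal a b).ennreal_ofReal

lemma measurable_gammaPDF (a r : ℝ) : Measurable (gammaPDF a r) :=
  (measurable_gammaPDFReal a r).ennreal_ofReal

lemma integral_betaMeasure (ha : 0 < a) (hb : 0 < b) (f : ℝ → ℝ) :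
    ∫ x, f x ∂betaMeasure a b = ∫ x, betaPDFReal a b x * f x := by
  have hnonneg (x : ℝ) : 0 ≤ betaPDFReal a b x := by
    have := beta_pos ha hb
    unfold betaPDFReal
    split_ifs with hx
    · have := sub_pos.2 hx.2
      have := hx.1
      positivity
    · exact le_rfl
  rw [betaMeasure, integral_withDensity_eq_integral_toReal_smul
    (measurable_betaPDF a b) (ae_of_all _ fun x => ENNReal.ofReal_lt_top)]
  simp only [betaPDF, ENNReal.toReal_ofReal (hnonneg _), smul_eq_mul]

lemma integral_gammaMeasure (ha : 0 < a) (hr : 0 < r) (f : ℝ → ℝ) :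
    ∫ x, f x ∂gammaMeasure a r = ∫ x, gammaPDFReal a r x * f x := by
  rw [gammaMeasure, integral_withDensity_eq_integral_toReal_smul
    (measurable_gammaPDF a r) (ae_of_all _ fun x => ENNReal.ofReal_lt_top)]
  simp only [gammaPDF, ENNReal.toReal_ofReal (gammaPDFReal_nonneg ha hr _), smul_eq_mul]

lemma integral_betaPDFReal (ha : 0 < a) (hb : 0 < b) : ∫ x, betaPDFReal a b x = 1 := by
  have := isProbabilityMeasureBeta ha hb
  simpa using (integral_betaMeasure ha hb fun _ => 1).symm

lemma integral_gammaPDFReal (ha : 0 < a) (hr : 0 < r) : ∫ x, gammaPDFReal a r x = 1 := by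
  have := isProbabilityMeasure_gammaMeasure ha hr
  simpa using (integral_gammaMeasure ha hr fun _ => 1).symm

lemma ae_betaMeasure_mem_Ioo (a b : ℝ) : ∀ᵐ x ∂betaMeasure a b, x ∈ Ioo 0 1 := by
  rw [betaMeasure, ae_withDensity_iff (measurable_betaPDF a b)]
  refine ae_of_all _ fun x hx => ?_
  by_contra h
  exact hx (by rw [betaPDF_eq, if_neg (by exact h), ENNReal.ofReal_zero])

lemma ae_gammaMeasure_pos (a r : ℝ) : ∀ᵐ x ∂gammaMeasure a r, 0 < x := by
  rw [gammaMeasure, ae_withDensity_iff (measurable_gammaPDF a r)]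
  filter_upwards [Measure.ae_ne volume 0] with x hx0 hx
  by_contra! h
  exact hx (gammaPDF_of_neg (h.lt_of_ne hx0))

lemma integral_pow_betaMeasure (ha : 0 < a) (hb : 0 < b) (k : ℕ) :
    ∫ x, x ^ k ∂betaMeasure a b =
      (ascPochhammer ℝ k).eval a / (ascPochhammer ℝ k).eval (a + b) := by
  have hak : 0 < a + k := by positivity
  have hbeta : beta (a + k) b / beta a b =
      (ascPochhammer ℝ k).eval a / (ascPochhammer ℝ k).eval (a + b) := by
    have := Real.Gamma_pos_of_pos ha
    have := Real.Gamma_pos_of_pos hb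
    have := Real.Gamma_pos_of_pos (add_pos ha hb)
    have := ascPochhammer_pos k (a + b) (add_pos ha hb)
    rw [beta, beta, add_right_comm, Gamma_add_natCast_eq_mul_ascPochhammer ha,
      Gamma_add_natCast_eq_mul_ascPochhammer (add_pos ha hb)]
    field_simp
  have hdensity (x : ℝ) : betaPDFReal a b x * x ^ k =
      beta (a + k) b / beta a b * betaPDFReal (a + k) b x := by
    have := beta_pos ha hb
    have := beta_pos hak hb
    unfold betaPDFReal
    split_ifs with hx
    · rw [show a + k - 1 = a - 1 + k by ring, Real.rpow_add hx.1, Real.rpow_natCast]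
      field_simp
    · simp
  rw [integral_betaMeasure ha hb]
  simp_rw [hdensity]
  rw [integral_const_mul, integral_betaPDFReal hak hb, mul_one, hbeta]

lemma integral_pow_gammaMeasure (ha : 0 < a) (hr : 0 < r) (k : ℕ) :
    ∫ x, x ^ k ∂gammaMeasure a r = (ascPochhammer ℝ k).eval a / r ^ k := by
  have hak : 0 < a + k := by positivity
  have hdensity : (fun x => gammaPDFReal a r x * x ^ k) =ᵐ[volume]
      fun x => (ascPochhammer ℝ k).eval a / r ^ k * gammaPDFReal (a + k) r x := by
    filter_upwards [Measure.ae_ne volume 0] with x hx0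
    have := Real.Gamma_pos_of_pos ha
    have := ascPochhammer_pos k a ha
    unfold gammaPDFReal
    split_ifs with hx
    · have hx : 0 < x := hx.lt_of_ne' hx0
      rw [show a + k - 1 = a - 1 + k by ring, Real.rpow_add hx, Real.rpow_natCast,
        Real.rpow_add hr, Real.rpow_natCast, Gamma_add_natCast_eq_mul_ascPochhammer ha]
      field_simp
    · simp
  rw [integral_gammaMeasure ha hr, integral_congr_ae hdensity, integral_const_mul,
    integral_gammaPDFReal hak hr, mul_one]

lemma integrable_pow_gammaMeasure (ha : 0 < a) (hr : 0 < r) (k : ℕ) :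
    Integrable (fun x => x ^ k) (gammaMeasure a r) := by
  refine .of_integral_ne_zero ?_
  rw [integral_pow_gammaMeasure ha hr]
  have := ascPochhammer_pos k a ha
  positivity

lemma gammaPDFReal_le (ha : 0 < a) (ha1 : a ≤ 1) (hr : 0 < r) {x : ℝ} (hx : 0 < x) :
    gammaPDFReal a r x ≤ (Real.Gamma a * x)⁻¹ := by
  have hrx : 0 < r * x := by positivity
  have := Real.Gamma_pos_of_pos ha
  have hpow : (r * x) ^ a ≤ Real.exp (r * x) := by
    calc (r * x) ^ a ≤ Real.exp (r * x) ^ a :=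
          Real.rpow_le_rpow hrx.le (by linarith [Real.add_one_le_exp (r * x)]) ha.le
      _ ≤ Real.exp (r * x) ^ (1 : ℝ) :=
          Real.rpow_le_rpow_of_exponent_le (Real.one_le_exp hrx.le) ha1
      _ = Real.exp (r * x) := Real.rpow_one _
  calc gammaPDFReal a r x
      = (r * x) ^ a * Real.exp (-(r * x)) * (Real.Gamma a * x)⁻¹ := by
        rw [gammaPDFReal, if_pos hx.le, Real.rpow_sub_one hx.ne', Real.mul_rpow hr.le hx.le]
        field_simp
    _ ≤ Real.exp (r * x) * Real.exp (-(r * x)) * (Real.Gamma a * x)⁻¹ := by gcongr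
    _ = (Real.Gamma a * x)⁻¹ := by rw [← Real.exp_add, add_neg_cancel, Real.exp_zero, one_mul]

/-! ### Bounds for `auxH` -/

lemma integrable_exp_mul_betaMeasure (ha : 0 < a) (hb : 0 < b) (u : ℝ) :
    Integrable (fun x => Real.exp (u * x)) (betaMeasure a b) := by
  have := isProbabilityMeasureBeta ha hb
  refine .of_bound (by fun_prop) (Real.exp |u|) ?_
  filter_upwards [ae_betaMeasure_mem_Ioo a b] with x hx
  rw [Real.norm_of_nonneg (by positivity), Real.exp_le_exp]
  calc u * x ≤ |u| * x := by gcongr; exacts [hx.1.le, le_abs_self u]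
    _ ≤ |u| := mul_le_of_le_one_right (abs_nonneg u) hx.2.le

lemma confluentHypergeometric_eq_integral (ha : 0 < a) (hb : 0 < b) (u : ℝ) :
    confluentHypergeometric a (a + b) u = ∫ x, Real.exp (u * x) ∂betaMeasure a b := by
  have := isProbabilityMeasureBeta ha hb
  have h := hasSum_integral_of_dominated_convergence (μ := betaMeasure a b)
    (F := fun (k : ℕ) (x : ℝ) => (u * x) ^ k / (k.factorial : ℝ)) (f := fun x => Real.exp (u * x))
    (fun (k : ℕ) (_ : ℝ) => |u| ^ k / (k.factorial : ℝ)) (fun k => by fun_prop) (fun k => ?_)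
    (ae_of_all _ fun _ => Real.summable_pow_div_factorial |u|) (integrable_const _)
    (ae_of_all _ fun x => ?_)
  · rw [← h.tsum_eq, confluentHypergeometric]
    refine tsum_congr fun k => ?_
    simp_rw [mul_pow, mul_div_right_comm]
    rw [integral_const_mul, integral_pow_betaMeasure ha hb]
    ring
  · filter_upwards [ae_betaMeasure_mem_Ioo a b] with x hx
    rw [Real.norm_eq_abs, abs_div, abs_pow, abs_mul, abs_of_pos hx.1, Nat.abs_cast]
    gcongr
    · have := hx.1
      positivity
    · exact mul_le_of_le_one_right (abs_nonneg u) hx.2.le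
  · rw [Real.exp_eq_exp_ℝ]
    exact NormedSpace.expSeries_div_hasSum_exp _

variable {η δ u : ℝ}

lemma auxH_pos (hη : 0 < η) (hδ : 0 < δ) (hu : 0 < u) : 0 < auxH η (η + δ) u := by
  have := isProbabilityMeasureBeta hη hδ
  have := Real.Gamma_pos_of_pos hη
  have := Real.Gamma_pos_of_pos (add_pos hη hδ)
  have := integral_exp_pos (integrable_exp_mul_betaMeasure hη hδ u)
  rw [auxH, confluentHypergeometric_eq_integral hη hδ]
  positivity

/-- Euler's integral for `₁F₁`, in which the factor `u ^ δ * exp (-u)` turns the beta density into a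
gamma density. -/
lemma auxH_eq_integral_gammaMeasure (hη : 0 < η) (hδ : 0 < δ) (hu : 0 < u) :
    auxH η (η + δ) u = ∫ x in Ioo 0 1, (1 - x) ^ (η - 1) ∂gammaMeasure δ u := by
  have := Real.Gamma_pos_of_pos hη
  have := Real.Gamma_pos_of_pos hδ
  have := Real.Gamma_pos_of_pos (add_pos hη hδ)
  rw [← integral_indicator measurableSet_Ioo, integral_gammaMeasure hδ hu, auxH,
    confluentHypergeometric_eq_integral hη hδ, integral_betaMeasure hη hδ,
    ← integral_sub_left_eq_self _ volume 1, ← integral_const_mul]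
  congr 1 with x
  by_cases hx : x ∈ Ioo 0 1
  · rw [indicator_of_mem hx, betaPDFReal, if_pos ⟨sub_pos.2 hx.2, sub_lt_self 1 hx.1⟩, beta,
      sub_sub_cancel, gammaPDFReal, if_pos hx.1.le, add_sub_cancel_left,
      show u * (1 - x) = u + -(u * x) by ring, Real.exp_add, Real.exp_neg]
    field_simp
  · rw [indicator_of_notMem hx, betaPDFReal,
      if_neg fun h => hx ⟨(sub_lt_self_iff 1).1 h.2, sub_pos.1 h.1⟩]
    ring

lemma auxH_self (hη : 0 < η) (u : ℝ) : auxH η η u = 1 := by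
  have hexp : confluentHypergeometric η η u = Real.exp u := by
    rw [confluentHypergeometric, Real.exp_eq_exp_ℝ, NormedSpace.exp_eq_tsum_div]
    refine tsum_congr fun k => ?_
    rw [div_self (ascPochhammer_pos k η hη).ne', one_mul]
  rw [auxH, hexp, div_self (Real.Gamma_pos_of_pos hη).ne', sub_self, Real.rpow_zero, one_mul,
    one_mul, ← Real.exp_add, neg_add_cancel, Real.exp_zero]

lemma auxH_lt_one (hη : 1 ≤ η) (hδ : 0 < δ) (hu : 0 < u) : auxH η (η + δ) u < 1 := by
  have := isProbabilityMeasure_gammaMeasure hδ hu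
  have hle : ∀ x ∈ Ioo (0 : ℝ) 1, ‖(1 - x) ^ (η - 1)‖ ≤ 1 := fun x hx => by
    have := sub_pos.2 hx.2
    rw [Real.norm_of_nonneg (by positivity)]
    exact Real.rpow_le_one this.le (by linarith [hx.1]) (by linarith)
  have htail : (gammaMeasure δ u).real (Ioo 0 1) < 1 := by
    have hpos : 0 < (gammaMeasure δ u).real (Ioo 0 1)ᶜ := by
      refine ENNReal.toReal_pos (fun h => ?_) (measure_ne_top _ _)
      rw [gammaMeasure, withDensity_apply_eq_zero (measurable_gammaPDF δ u)] at h
      have hsub : Ici (1 : ℝ) ⊆ {x | gammaPDF δ u x ≠ 0} ∩ (Ioo 0 1)ᶜ := fun x (hx : 1 ≤ x) =>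
        ⟨(ENNReal.ofReal_pos.2 (gammaPDFReal_pos hδ hu (by linarith))).ne', fun h => h.2.not_ge hx⟩
      simpa using measure_mono_null hsub h
    rw [measureReal_compl measurableSet_Ioo, probReal_univ] at hpos
    linarith
  calc auxH η (η + δ) u = ∫ x in Ioo 0 1, (1 - x) ^ (η - 1) ∂gammaMeasure δ u :=
        auxH_eq_integral_gammaMeasure (by linarith) hδ hu
    _ ≤ 1 * (gammaMeasure δ u).real (Ioo 0 1) :=
        (le_abs_self _).trans (norm_setIntegral_le_of_norm_le_const (measure_lt_top _ _) hle)
    _ < 1 := by rwa [one_mul]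

lemma integrableOn_one_sub_rpow (hη : 0 < η) :
    IntegrableOn (fun x : ℝ => (1 - x) ^ (η - 1)) (Ioo 0 1) := by
  have h := (intervalIntegral.intervalIntegrable_rpow' (a := 0) (b := 1)
    (show -1 < η - 1 by linarith)).comp_sub_left 1
  rw [sub_zero, sub_self] at h
  exact (intervalIntegrable_iff_integrableOn_Ioo_of_le zero_le_one).1 h.symm

/-- The singularity of `(1 - x) ^ (η - 1)` lies in `x ≥ 1 / 2`, where the gamma densities are
bounded uniformly in the rate. -/
lemma gammaPDFReal_mul_one_sub_rpow_le (hη1 : η ≤ 1) (hδ : 0 < δ) (hδ1 : δ ≤ 1)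
    (hu : 0 < u) {x : ℝ} (hx : x ∈ Ioo 0 1) :
    gammaPDFReal δ u x * (1 - x) ^ (η - 1) ≤
      2 ^ (1 - η) * gammaPDFReal δ u x + 2 / Real.Gamma δ * (1 - x) ^ (η - 1) := by
  have hx1 := sub_pos.2 hx.2
  have hpdf := gammaPDFReal_pos hδ hu hx.1
  have := Real.Gamma_pos_of_pos hδ
  have hleft : 0 ≤ 2 ^ (1 - η) * gammaPDFReal δ u x := by positivity
  have hright : 0 ≤ 2 / Real.Gamma δ * (1 - x) ^ (η - 1) := by positivity
  rcases le_total x (1 / 2) with h | h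
  · have : (1 - x) ^ (η - 1) ≤ 2 ^ (1 - η) := by
      rw [← neg_sub 1 η, Real.rpow_neg hx1.le, ← Real.inv_rpow hx1.le]
      refine Real.rpow_le_rpow (by positivity) ?_ (by linarith)
      rw [inv_le_comm₀ hx1 two_pos]
      linarith
    nlinarith
  · have : gammaPDFReal δ u x ≤ 2 / Real.Gamma δ := by
      have hx0 := hx.1
      refine (gammaPDFReal_le hδ hδ1 hu hx0).trans ?_
      rw [mul_inv, div_eq_inv_mul]
      gcongr
      rw [inv_le_comm₀ hx0 two_pos]
      linarith
    nlinarith [Real.rpow_pos_of_pos hx1 (η - 1)]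

lemma exists_auxH_le (hη : 0 < η) (hη1 : η ≤ 1) (hδ : 0 < δ) (hδ1 : δ ≤ 1) :
    ∃ c, ∀ u, 0 < u → auxH η (η + δ) u ≤ c := by
  refine ⟨2 ^ (1 - η) + 2 / Real.Gamma δ * ∫ x in Ioo (0 : ℝ) 1, (1 - x) ^ (η - 1),
    fun u hu => ?_⟩
  have := Real.Gamma_pos_of_pos hδ
  have hpdf : Integrable (gammaPDFReal δ u) :=
    .of_integral_ne_zero (by rw [integral_gammaPDFReal hδ hu]; exact one_ne_zero)
  have hpow := (integrable_indicator_iff measurableSet_Ioo).2 (integrableOn_one_sub_rpow hη)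
  rw [auxH_eq_integral_gammaMeasure hη hδ hu, ← integral_indicator measurableSet_Ioo,
    integral_gammaMeasure hδ hu, ← integral_indicator measurableSet_Ioo]
  calc ∫ x, gammaPDFReal δ u x * (Ioo 0 1).indicator (fun x => (1 - x) ^ (η - 1)) x
      ≤ ∫ x, (2 ^ (1 - η) * gammaPDFReal δ u x +
          2 / Real.Gamma δ * (Ioo 0 1).indicator (fun x => (1 - x) ^ (η - 1)) x) := by
        refine integral_mono_of_nonneg (ae_of_all _ fun x => ?_)
          ((hpdf.const_mul _).add (hpow.const_mul _)) (ae_of_all _ fun x => ?_)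
        · exact mul_nonneg (gammaPDFReal_nonneg hδ hu x)
            (indicator_nonneg (fun y hy => Real.rpow_nonneg (sub_pos.2 hy.2).le _) x)
        · by_cases hx : x ∈ Ioo 0 1
          · simpa only [indicator_of_mem hx] using
              gammaPDFReal_mul_one_sub_rpow_le hη1 hδ hδ1 hu hx
          · have := gammaPDFReal_nonneg hδ hu x
            simp only [indicator_of_notMem hx, mul_zero, add_zero]
            positivity
    _ = _ := by
        rw [integral_add (hpdf.const_mul _) (hpow.const_mul _), integral_const_mul,
          integral_const_mul, integral_gammaPDFReal hδ hu, mul_one]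

lemma one_add_mul_le_one_sub_rpow_neg {x s : ℝ} (hx : x < 1) (hs : 0 ≤ s) :
    1 + s * x ≤ (1 - x) ^ (-s) := by
  have hexp : 1 - x ≤ Real.exp (-x) := Real.one_sub_le_exp_neg x
  calc 1 + s * x ≤ Real.exp (s * x) := by linarith [Real.add_one_le_exp (s * x)]
    _ = Real.exp (-x) ^ (-s) := by rw [← Real.exp_mul]; ring_nf
    _ ≤ (1 - x) ^ (-s) :=
        Real.rpow_le_rpow_of_nonpos (sub_pos.2 hx) hexp (neg_nonpos.2 hs)

/-- The first two moments of the gamma distribution show that `auxH η (η + δ)` exceeds `1` by about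
`(1 - η) * δ / u`. -/
lemma one_lt_auxH (hη : 0 < η) (hη1 : η < 1) (hδ : 0 < δ) (hu : 2 * (δ + 1) / (1 - η) < u) :
    1 < auxH η (η + δ) u := by
  have hη' : 0 < 1 - η := sub_pos.2 hη1
  have hu0 : 0 < u := lt_trans (by positivity) hu
  have := isProbabilityMeasure_gammaMeasure hδ hu0
  have hpow := integrable_pow_gammaMeasure hδ hu0
  have hlin : Integrable (fun x => x ^ 0 + (1 - η) * x ^ 1) (gammaMeasure δ u) :=
    (hpow 0).add ((hpow 1).const_mul _)
  have hint : IntegrableOn (fun x => (1 - x) ^ (η - 1)) (Ioo 0 1) (gammaMeasure δ u) :=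
    .of_integral_ne_zero (by
      rw [← auxH_eq_integral_gammaMeasure hη hδ hu0]
      exact (auxH_pos hη hδ hu0).ne')
  rw [div_lt_iff₀ hη'] at hu
  calc 1 < 1 + (1 - η) * (δ / u) - 2 * (δ * (δ + 1) / u ^ 2) := by
        rw [← sub_pos, show 1 + (1 - η) * (δ / u) - 2 * (δ * (δ + 1) / u ^ 2) - 1 =
          δ * (u * (1 - η) - 2 * (δ + 1)) / u ^ 2 by field_simp; ring]
        have := sub_pos.2 hu
        positivity
    _ = ∫ x, (x ^ 0 + (1 - η) * x ^ 1 - 2 * x ^ 2) ∂gammaMeasure δ u := by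
        rw [integral_sub hlin ((hpow 2).const_mul _),
          integral_add (hpow 0) ((hpow 1).const_mul _), integral_const_mul, integral_const_mul]
        simp only [integral_pow_gammaMeasure hδ hu0, ascPochhammer_succ_eval, ascPochhammer_zero,
          Polynomial.eval_one, Nat.cast_zero, Nat.cast_one]
        ring
    _ ≤ ∫ x, (Ioo 0 1).indicator (fun x => (1 - x) ^ (η - 1)) x ∂gammaMeasure δ u := by
        refine integral_mono_ae (hlin.sub ((hpow 2).const_mul _))
          ((integrable_indicator_iff measurableSet_Ioo).2 hint) ?_
        filter_upwards [ae_gammaMeasure_pos δ u] with x hx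
        rw [pow_zero, pow_one]
        rcases lt_or_ge x 1 with hx1 | hx1
        · rw [indicator_of_mem (show x ∈ Ioo 0 1 from ⟨hx, hx1⟩), ← neg_sub 1 η]
          linarith [one_add_mul_le_one_sub_rpow_neg hx1 hη'.le, sq_nonneg x]
        · rw [indicator_of_notMem fun h => h.2.not_ge hx1]
          nlinarith
    _ = auxH η (η + δ) u := by
        rw [integral_indicator measurableSet_Ioo, auxH_eq_integral_gammaMeasure hη hδ hu0]

end BetaGamma

section AuxHBessel

variable {α u : ℝ}

lemma auxH_bessel_eq (α u : ℝ) : auxH (α / 2 + 3 / 4) (α + 1) u =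
    auxH (α / 2 + 3 / 4) (α / 2 + 3 / 4 + (α / 2 + 1 / 4)) u := by
  ring_nf

lemma auxH_bessel_lt_one (hα : 1 / 2 ≤ α) (hu : 0 < u) : auxH (α / 2 + 3 / 4) (α + 1) u < 1 := by
  rw [auxH_bessel_eq]
  exact auxH_lt_one (by linarith) (by linarith) hu

lemma auxH_bessel_neg_half (u : ℝ) : auxH (-1 / 2 / 2 + 3 / 4) (-1 / 2 + 1) u = 1 := by
  convert auxH_self one_half_pos u <;> norm_num

lemma exists_auxH_bessel_le (hα : -1 / 2 ≤ α) :
    ∃ c, 1 < c ∧ ∀ u, 0 < u → auxH (α / 2 + 3 / 4) (α + 1) u ≤ c := by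
  suffices h : ∃ c, ∀ u, 0 < u → auxH (α / 2 + 3 / 4) (α + 1) u ≤ c by
    obtain ⟨c, hc⟩ := h
    exact ⟨max c 2, lt_max_of_lt_right one_lt_two, fun u hu => (hc u hu).trans (le_max_left _ _)⟩
  rcases hα.eq_or_lt with rfl | hα
  · exact ⟨1, fun u _ => (auxH_bessel_neg_half u).le⟩
  rcases le_total α (1 / 2) with h | h
  · simp_rw [auxH_bessel_eq]
    exact exists_auxH_le (by linarith) (by linarith) (by linarith) (by linarith)
  · exact ⟨1, fun u hu => (auxH_bessel_lt_one h hu).le⟩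

lemma exists_one_lt_auxH_bessel (hα : -1 / 2 < α) (hα' : α < 1 / 2) :
    ∃ u₀, ∀ u, u₀ < u → 1 < auxH (α / 2 + 3 / 4) (α + 1) u := by
  refine ⟨2 * ((α / 2 + 1 / 4) + 1) / (1 - (α / 2 + 3 / 4)), fun u hu => ?_⟩
  rw [auxH_bessel_eq]
  exact one_lt_auxH (by linarith) (by linarith) (by linarith) hu

end AuxHBessel

/-! ### Functions in `L¹ + L^∞` -/

section L1AddLinfty

variable {X 𝕜 : Type*} [MeasurableSpace X] [RCLike 𝕜] {μ : Measure X} {f : X → 𝕜}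

theorem MemL1AddLinfty.aestronglyMeasurable (hf : MemL1AddLinfty μ f) :
    AEStronglyMeasurable f μ := by
  obtain ⟨g, h, hg, hh, rfl⟩ := hf
  exact hg.1.add hh.1

theorem MemL1AddLinfty.of_memLp {p : ℝ≥0∞} (hp : 1 ≤ p) (hf : MemLp f p μ) :
    MemL1AddLinfty μ f := by
  rcases eq_or_ne p ∞ with rfl | hp_top
  · exact ⟨0, f, MemLp.zero, hf, (zero_add f).symm⟩
  have hp_one : 1 ≤ p.toReal := by simpa using ENNReal.toReal_mono hp_top hp
  have hlarge : NullMeasurableSet {x | 1 ≤ ‖f x‖} μ :=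
    nullMeasurableSet_le aemeasurable_const hf.1.norm.aemeasurable
  refine ⟨{x | 1 ≤ ‖f x‖}.indicator f, {x | 1 ≤ ‖f x‖}ᶜ.indicator f, ?_, ?_,
    (indicator_self_add_compl _ f).symm⟩
  · rw [memLp_one_iff_integrable]
    refine (hf.integrable_norm_rpow (zero_lt_one.trans_le hp).ne' hp_top).mono'
      (hf.1.indicator₀ hlarge) (Eventually.of_forall fun x => ?_)
    by_cases hx : 1 ≤ ‖f x‖
    · rw [indicator_of_mem (show x ∈ {x | 1 ≤ ‖f x‖} from hx)]
      exact Real.self_le_rpow_of_one_le hx hp_one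
    · rw [indicator_of_notMem (show x ∉ {x | 1 ≤ ‖f x‖} from hx), norm_zero]
      positivity
  · refine memLp_top_of_bound (hf.1.indicator₀ hlarge.compl) 1 (Eventually.of_forall fun x => ?_)
    by_cases hx : 1 ≤ ‖f x‖
    · rw [indicator_of_notMem (show x ∉ {x | 1 ≤ ‖f x‖}ᶜ from not_not.2 hx), norm_zero]
      exact zero_le_one
    · rw [indicator_of_mem (show x ∈ {x | 1 ≤ ‖f x‖}ᶜ from hx)]
      exact (not_le.1 hx).le

theorem integrable_smul_of_memLp_top {w : X → ℝ} (hw : Integrable w μ)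
    (hf : MemLp f ∞ μ) : Integrable (fun x => w x • f x) μ :=
  memLp_one_iff_integrable.1 (hf.smul (memLp_one_iff_integrable.2 hw))

theorem MemL1AddLinfty.integrable_smul (hf : MemL1AddLinfty μ f) {w : X → ℝ} {C : ℝ}
    (hw : Integrable w μ) (hC : ∀ᵐ x ∂μ, ‖w x‖ ≤ C) : Integrable (fun x => w x • f x) μ := by
  obtain ⟨g, h, hg, hh, rfl⟩ := hf
  simp only [Pi.add_apply, smul_add]
  exact ((memLp_one_iff_integrable.1 hg).bdd_smul C hw.1 hC).add
    (integrable_smul_of_memLp_top hw hh)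

end L1AddLinfty

/-! ### Integral operators with symmetric kernels -/

/-- The integral operator with kernel `k`. -/
def kernelOp {X 𝕜 : Type*} [MeasurableSpace X] [RCLike 𝕜] (μ : Measure X) (k : X → X → ℝ)
    (f : X → 𝕜) (x : X) : 𝕜 :=
  ∫ y, k x y • f y ∂μ

/-- A symmetric kernel satisfying the hypothesis of the Schur test with constant `c`; by symmetry
one bound on the row integrals suffices. -/
structure IsSchurKernel {X : Type*} [MeasurableSpace X] (μ : Measure X) (k : X → X → ℝ)
    (c : NNReal) : Prop where
  measurable : Measurable (Function.uncurry k)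
  symm : ∀ x y, k x y = k y x
  lintegral_le : ∀ᵐ x ∂μ, ∫⁻ y, ‖k x y‖ₑ ∂μ ≤ c

section Kernel

variable {X 𝕜 : Type*} [MeasurableSpace X] [RCLike 𝕜] {μ : Measure X} {k : X → X → ℝ}

theorem enorm_kernelOp_le (f : X → 𝕜) (x : X) :
    ‖kernelOp μ k f x‖ₑ ≤ ∫⁻ y, ‖k x y‖ₑ * ‖f y‖ₑ ∂μ :=
  (enorm_integral_le_lintegral_enorm _).trans_eq (by simp_rw [enorm_smul])

theorem kernelOp_congr_ae {f g : X → 𝕜} (h : f =ᵐ[μ] g) : kernelOp μ k f = kernelOp μ k g := by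
  funext x
  refine integral_congr_ae ?_
  filter_upwards [h] with y hy
  rw [hy]

theorem kernelOp_smul (a : 𝕜) (f : X → 𝕜) : kernelOp μ k (a • f) = a • kernelOp μ k f := by
  funext x
  simp_rw [kernelOp, Pi.smul_apply, kernelOp, smul_comm _ a]
  exact integral_smul a _

theorem kernelOp_add_apply {f g : X → 𝕜} {x : X} (hf : Integrable (fun y => k x y • f y) μ)
    (hg : Integrable (fun y => k x y • g y) μ) :
    kernelOp μ k (f + g) x = kernelOp μ k f x + kernelOp μ k g x := by
  simp only [kernelOp, Pi.add_apply, smul_add]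
  exact integral_add hf hg

theorem kernelOp_nonneg (hk : ∀ x y, 0 ≤ k x y) {f : X → 𝕜} (hf : ∀ᵐ x ∂μ, 0 ≤ f x) (x : X) :
    0 ≤ kernelOp μ k f x := by
  refine integral_nonneg_of_ae ?_
  filter_upwards [hf] with y hy
  exact smul_nonneg (hk x y) hy

theorem inner_kernelOp_left (f : X → 𝕜) (x : X) (b : 𝕜) :
    inner 𝕜 (kernelOp μ k f x) b = ∫ y, k x y • inner 𝕜 (f y) b ∂μ := by
  simp_rw [kernelOp, RCLike.inner_apply, ← integral_conj, ← integral_const_mul,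
    RCLike.real_smul_eq_coe_mul, map_mul, RCLike.conj_ofReal, mul_left_comm b]

theorem inner_kernelOp_right (b : 𝕜) (f : X → 𝕜) (x : X) :
    inner 𝕜 b (kernelOp μ k f x) = ∫ y, k x y • inner 𝕜 b (f y) ∂μ := by
  simp_rw [kernelOp, RCLike.inner_apply, ← integral_mul_const, smul_mul_assoc]

variable [SFinite μ]

theorem aestronglyMeasurable_kernelOp (hk : Measurable (Function.uncurry k)) {f : X → 𝕜}
    (hf : AEStronglyMeasurable f μ) : AEStronglyMeasurable (kernelOp μ k f) μ :=
  AEStronglyMeasurable.integral_prod_right' (f := fun q : X × X => k q.1 q.2 • f q.2)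
    (hk.aestronglyMeasurable.smul hf.comp_snd)

theorem integral_inner_kernelOp (hsymm : ∀ x y, k x y = k y x) {f g : X → 𝕜}
    (h : Integrable (fun q : X × X => k q.1 q.2 • inner 𝕜 (f q.2) (g q.1)) (μ.prod μ)) :
    ∫ x, inner 𝕜 (kernelOp μ k f x) (g x) ∂μ = ∫ x, inner 𝕜 (f x) (kernelOp μ k g x) ∂μ := by
  calc ∫ x, inner 𝕜 (kernelOp μ k f x) (g x) ∂μ
      = ∫ x, ∫ y, k x y • inner 𝕜 (f y) (g x) ∂μ ∂μ := by simp_rw [inner_kernelOp_left]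
    _ = ∫ y, ∫ x, k x y • inner 𝕜 (f y) (g x) ∂μ ∂μ := integral_integral_swap h
    _ = ∫ y, inner 𝕜 (f y) (kernelOp μ k g y) ∂μ := by
        simp_rw [inner_kernelOp_right, fun y x => hsymm x y]

theorem kernelOp_kernelOp {k₁ k₂ k₃ : X → X → ℝ} (hk₁ : Measurable (Function.uncurry k₁))
    (hk₂ : Measurable (Function.uncurry k₂)) (hk₁_nonneg : ∀ x y, 0 ≤ k₁ x y)
    (hk₂_nonneg : ∀ x y, 0 ≤ k₂ x y) {f : X → 𝕜} (hf : AEStronglyMeasurable f μ) {x : X}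
    (hint : ∀ᵐ z ∂μ, Integrable (fun y => k₁ x y * k₂ y z) μ)
    (hcomp : ∀ᵐ z ∂μ, ∫ y, k₁ x y * k₂ y z ∂μ = k₃ x z)
    (hk₃ : Integrable (fun z => k₃ x z • f z) μ) :
    kernelOp μ k₁ (kernelOp μ k₂ f) x = kernelOp μ k₃ f x := by
  have hmeas : AEStronglyMeasurable (fun q : X × X => (k₁ x q.1 * k₂ q.1 q.2) • f q.2)
      (μ.prod μ) :=
    (((hk₁.comp measurable_prodMk_left).comp measurable_fst).mul hk₂).aestronglyMeasurable.smul
      hf.comp_snd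
  have hprod : Integrable (fun q : X × X => (k₁ x q.1 * k₂ q.1 q.2) • f q.2) (μ.prod μ) := by
    rw [integrable_prod_iff' hmeas]
    refine ⟨?_, hk₃.norm.congr ?_⟩
    · filter_upwards [hint] with z hz
      exact hz.smul_const _
    · filter_upwards [hcomp] with z hz
      have hpos : 0 ≤ k₃ x z :=
        hz ▸ integral_nonneg fun y => mul_nonneg (hk₁_nonneg x y) (hk₂_nonneg y z)
      simp_rw [norm_smul, Real.norm_of_nonneg (mul_nonneg (hk₁_nonneg x _) (hk₂_nonneg _ z))]
      rw [integral_mul_const, hz, Real.norm_of_nonneg hpos]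
  calc kernelOp μ k₁ (kernelOp μ k₂ f) x
      = ∫ y, ∫ z, (k₁ x y * k₂ y z) • f z ∂μ ∂μ := by
        simp_rw [kernelOp, ← integral_smul, smul_smul]
    _ = ∫ z, ∫ y, (k₁ x y * k₂ y z) • f z ∂μ ∂μ := integral_integral_swap hprod
    _ = kernelOp μ k₃ f x := by
        refine integral_congr_ae ?_
        filter_upwards [hcomp] with z hz
        rw [integral_smul_const, hz]

end Kernel

section Schur

variable {X 𝕜 : Type*} [MeasurableSpace X] [RCLike 𝕜] {μ : Measure X} {k : X → X → ℝ} {c : NNReal}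

theorem lintegral_mul_rpow_le {p : ℝ} (hp : 1 ≤ p) {K F : X → ℝ≥0∞}
    (hK : AEMeasurable K μ) (hF : AEMeasurable F μ) :
    (∫⁻ y, K y * F y ∂μ) ^ p ≤ (∫⁻ y, K y ∂μ) ^ (p - 1) * ∫⁻ y, K y * F y ^ p ∂μ := by
  have hp_pos : 0 < p := by linarith
  have hp_inv : 0 ≤ 1 - p⁻¹ := by linarith [inv_le_one_of_one_le₀ hp]
  have hfactor (y : X) : K y ^ (1 - p⁻¹) * (K y * F y ^ p) ^ p⁻¹ = K y * F y := by
    rw [ENNReal.mul_rpow_of_nonneg _ _ (inv_nonneg.2 hp_pos.le), ENNReal.rpow_rpow_inv hp_pos.ne',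
      ← mul_assoc, ← ENNReal.rpow_add_of_nonneg _ _ hp_inv (inv_nonneg.2 hp_pos.le),
      sub_add_cancel, ENNReal.rpow_one]
  have hholder := ENNReal.lintegral_mul_norm_pow_le hK (hK.mul (hF.pow_const p)) hp_inv
    (inv_nonneg.2 hp_pos.le) (by ring)
  simp only [Pi.mul_apply, hfactor] at hholder
  calc (∫⁻ y, K y * F y ∂μ) ^ p
      ≤ ((∫⁻ y, K y ∂μ) ^ (1 - p⁻¹) * (∫⁻ y, K y * F y ^ p ∂μ) ^ p⁻¹) ^ p := by gcongr
    _ = (∫⁻ y, K y ∂μ) ^ (p - 1) * ∫⁻ y, K y * F y ^ p ∂μ := by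
        rw [ENNReal.mul_rpow_of_nonneg _ _ hp_pos.le, ENNReal.rpow_inv_rpow hp_pos.ne',
          ← ENNReal.rpow_mul]
        congr 2
        field_simp

namespace IsSchurKernel

theorem measurable_apply (hk : IsSchurKernel μ k c) (x : X) : Measurable (k x) :=
  hk.measurable.comp measurable_prodMk_left

theorem eLpNormEssSup_kernelOp_le (hk : IsSchurKernel μ k c) (f : X → 𝕜) :
    eLpNormEssSup (kernelOp μ k f) μ ≤ c * eLpNormEssSup f μ := by
  refine eLpNormEssSup_le_of_ae_enorm_bound ?_
  filter_upwards [hk.lintegral_le] with x hx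
  calc ‖kernelOp μ k f x‖ₑ ≤ ∫⁻ y, ‖k x y‖ₑ * ‖f y‖ₑ ∂μ := enorm_kernelOp_le f x
    _ ≤ ∫⁻ y, ‖k x y‖ₑ * eLpNormEssSup f μ ∂μ := by
        refine lintegral_mono_ae ?_
        filter_upwards [ae_le_eLpNormEssSup (f := f) (μ := μ)] with y hy
        gcongr
    _ = (∫⁻ y, ‖k x y‖ₑ ∂μ) * eLpNormEssSup f μ :=
        lintegral_mul_const _ (hk.measurable_apply x).enorm
    _ ≤ c * eLpNormEssSup f μ := by gcongr

variable [SFinite μ]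

theorem lintegral_lintegral_mul_le (hk : IsSchurKernel μ k c) {F : X → ℝ≥0∞}
    (hF : AEMeasurable F μ) : ∫⁻ x, ∫⁻ y, ‖k x y‖ₑ * F y ∂μ ∂μ ≤ c * ∫⁻ y, F y ∂μ := by
  rw [lintegral_lintegral_swap (hk.measurable.enorm.aemeasurable.mul hF.comp_snd),
    ← lintegral_const_mul'' _ hF]
  refine lintegral_mono_ae ?_
  filter_upwards [hk.lintegral_le] with y hy
  simp_rw [hk.symm _ y]
  rw [lintegral_mul_const _ (hk.measurable_apply y).enorm]
  gcongr

theorem lintegral_lintegral_mul_rpow_le (hk : IsSchurKernel μ k c) {p : ℝ} (hp : 1 ≤ p)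
    {F : X → ℝ≥0∞} (hF : AEMeasurable F μ) :
    ∫⁻ x, (∫⁻ y, ‖k x y‖ₑ * F y ∂μ) ^ p ∂μ ≤ c ^ p * ∫⁻ y, F y ^ p ∂μ := by
  have hmeas : AEMeasurable (fun x => ∫⁻ y, ‖k x y‖ₑ * F y ^ p ∂μ) μ :=
    AEMeasurable.lintegral_prod_right' (f := fun q : X × X => ‖k q.1 q.2‖ₑ * F q.2 ^ p)
      (hk.measurable.enorm.aemeasurable.mul (hF.comp_snd.pow_const p))
  calc ∫⁻ x, (∫⁻ y, ‖k x y‖ₑ * F y ∂μ) ^ p ∂μ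
      ≤ ∫⁻ x, c ^ (p - 1) * ∫⁻ y, ‖k x y‖ₑ * F y ^ p ∂μ ∂μ := by
        refine lintegral_mono_ae ?_
        filter_upwards [hk.lintegral_le] with x hx
        refine (lintegral_mul_rpow_le hp (hk.measurable_apply x).enorm.aemeasurable hF).trans ?_
        gcongr
    _ ≤ c ^ (p - 1) * (c * ∫⁻ y, F y ^ p ∂μ) := by
        rw [lintegral_const_mul'' _ hmeas]
        gcongr
        exact hk.lintegral_lintegral_mul_le (hF.pow_const p)
    _ = c ^ p * ∫⁻ y, F y ^ p ∂μ := by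
        rw [← mul_assoc]
        nth_rw 2 [← ENNReal.rpow_one (c : ℝ≥0∞)]
        rw [← ENNReal.rpow_add_of_nonneg _ _ (by linarith) zero_le_one, sub_add_cancel]

theorem eLpNorm_kernelOp_le (hk : IsSchurKernel μ k c) {p : ℝ≥0∞} (hp : 1 ≤ p)
    {f : X → 𝕜} (hf : AEStronglyMeasurable f μ) :
    eLpNorm (kernelOp μ k f) p μ ≤ c * eLpNorm f p μ := by
  rcases eq_or_ne p ∞ with rfl | hp_top
  · simpa only [eLpNorm_exponent_top] using hk.eLpNormEssSup_kernelOp_le f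
  have hp_one : 1 ≤ p.toReal := by simpa using ENNReal.toReal_mono hp_top hp
  have hp_pos : 0 < p.toReal := by linarith
  have hp_ne : p ≠ 0 := (zero_lt_one.trans_le hp).ne'
  simp only [eLpNorm_eq_lintegral_rpow_enorm_toReal hp_ne hp_top, one_div]
  calc (∫⁻ x, ‖kernelOp μ k f x‖ₑ ^ p.toReal ∂μ) ^ p.toReal⁻¹
      ≤ (∫⁻ x, (∫⁻ y, ‖k x y‖ₑ * ‖f y‖ₑ ∂μ) ^ p.toReal ∂μ) ^ p.toReal⁻¹ := by
        gcongr with x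
        exact enorm_kernelOp_le f x
    _ ≤ (c ^ p.toReal * ∫⁻ y, ‖f y‖ₑ ^ p.toReal ∂μ) ^ p.toReal⁻¹ := by
        gcongr
        exact hk.lintegral_lintegral_mul_rpow_le hp_one hf.enorm
    _ = c * (∫⁻ y, ‖f y‖ₑ ^ p.toReal ∂μ) ^ p.toReal⁻¹ := by
        rw [ENNReal.mul_rpow_of_nonneg _ _ (by positivity), ENNReal.rpow_rpow_inv hp_pos.ne']

theorem memLp_kernelOp (hk : IsSchurKernel μ k c) {p : ℝ≥0∞} (hp : 1 ≤ p) {f : X → 𝕜}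
    (hf : MemLp f p μ) : MemLp (kernelOp μ k f) p μ :=
  ⟨aestronglyMeasurable_kernelOp hk.measurable hf.1,
    (hk.eLpNorm_kernelOp_le hp hf.1).trans_lt (ENNReal.mul_lt_top ENNReal.coe_lt_top hf.2)⟩

theorem integrable_smul_snd (hk : IsSchurKernel μ k c) {f : X → 𝕜} (hf : Integrable f μ) :
    Integrable (fun q : X × X => k q.1 q.2 • f q.2) (μ.prod μ) := by
  have hmeas : AEStronglyMeasurable (fun q : X × X => k q.1 q.2 • f q.2) (μ.prod μ) :=
    hk.measurable.aestronglyMeasurable.smul hf.1.comp_snd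
  refine ⟨hmeas, ?_⟩
  rw [HasFiniteIntegral, lintegral_prod _ hmeas.enorm]
  simp_rw [enorm_smul]
  exact (hk.lintegral_lintegral_mul_le hf.1.enorm).trans_lt
    (ENNReal.mul_lt_top ENNReal.coe_lt_top hf.2)

theorem integrable_smul_fst (hk : IsSchurKernel μ k c) {f : X → 𝕜} (hf : Integrable f μ) :
    Integrable (fun q : X × X => k q.1 q.2 • f q.1) (μ.prod μ) := by
  simpa only [Function.comp_def, Prod.fst_swap, Prod.snd_swap, hk.symm _ (Prod.fst _)] using
    (hk.integrable_smul_snd hf).swap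

theorem ae_integrable_smul (hk : IsSchurKernel μ k c) {f : X → 𝕜} (hf : MemL1AddLinfty μ f) :
    ∀ᵐ x ∂μ, Integrable (fun y => k x y • f y) μ := by
  obtain ⟨g, h, hg, hh, rfl⟩ := hf
  filter_upwards [hk.lintegral_le,
    (hk.integrable_smul_snd (memLp_one_iff_integrable.1 hg)).prod_right_ae] with x hx hgx
  have hkx : Integrable (k x) μ :=
    ⟨(hk.measurable_apply x).aestronglyMeasurable, hx.trans_lt ENNReal.coe_lt_top⟩
  simp only [Pi.add_apply, smul_add]
  exact hgx.add (integrable_smul_of_memLp_top hkx hh)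

theorem kernelOp_add_ae (hk : IsSchurKernel μ k c) {f g : X → 𝕜} (hf : MemL1AddLinfty μ f)
    (hg : MemL1AddLinfty μ g) :
    kernelOp μ k (f + g) =ᵐ[μ] kernelOp μ k f + kernelOp μ k g := by
  filter_upwards [hk.ae_integrable_smul hf, hk.ae_integrable_smul hg] with x hfx hgx
  exact kernelOp_add_apply hfx hgx

theorem integrable_smul_inner (hk : IsSchurKernel μ k c) {f g : X → 𝕜} (hf : MemLp f 2 μ)
    (hg : MemLp g 2 μ) :
    Integrable (fun q : X × X => k q.1 q.2 • inner 𝕜 (f q.2) (g q.1)) (μ.prod μ) := by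
  have hf_sq := hk.integrable_smul_snd (hf.norm.integrable_sq)
  have hg_sq := hk.integrable_smul_fst (hg.norm.integrable_sq)
  refine (hf_sq.norm.add hg_sq.norm).mono' (hk.measurable.aestronglyMeasurable.smul
    (hf.1.comp_snd.inner hg.1.comp_fst)) (Eventually.of_forall fun q => ?_)
  have hinner : ‖(inner 𝕜 (f q.2) (g q.1) : 𝕜)‖ ≤ ‖f q.2‖ ^ 2 + ‖g q.1‖ ^ 2 := by
    nlinarith [norm_inner_le_norm (𝕜 := 𝕜) (f q.2) (g q.1), sq_nonneg (‖f q.2‖ - ‖g q.1‖),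
      sq_nonneg (‖f q.2‖ + ‖g q.1‖)]
  simp only [Pi.add_apply, norm_smul, norm_pow, norm_norm, ← mul_add]
  exact mul_le_mul_of_nonneg_left hinner (norm_nonneg _)

theorem integral_inner_kernelOp (hk : IsSchurKernel μ k c) {f g : X → 𝕜} (hf : MemLp f 2 μ)
    (hg : MemLp g 2 μ) :
    ∫ x, inner 𝕜 (kernelOp μ k f x) (g x) ∂μ = ∫ x, inner 𝕜 (f x) (kernelOp μ k g x) ∂μ :=
  _root_.integral_inner_kernelOp hk.symm (hk.integrable_smul_inner hf hg)

theorem norm_toLp_kernelOp_le (hk : IsSchurKernel μ k c) (f : Lp 𝕜 2 μ) :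
    ‖(hk.memLp_kernelOp one_le_two (Lp.memLp f)).toLp‖ ≤ c * ‖f‖ := by
  rw [Lp.norm_toLp, Lp.norm_def, ← ENNReal.coe_toReal, ← ENNReal.toReal_mul]
  exact ENNReal.toReal_mono (ENNReal.mul_ne_top ENNReal.coe_ne_top (Lp.memLp f).2.ne)
    (hk.eLpNorm_kernelOp_le one_le_two (Lp.memLp f).1)

variable (𝕜) in
/-- The bounded operator on `L²(μ)` defined by a Schur kernel. -/
def toL2 (hk : IsSchurKernel μ k c) : Lp 𝕜 2 μ →L[𝕜] Lp 𝕜 2 μ :=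
  LinearMap.mkContinuous
    { toFun := fun f => (hk.memLp_kernelOp one_le_two (Lp.memLp f)).toLp
      map_add' := fun f g => by
        rw [← MemLp.toLp_add, MemLp.toLp_eq_toLp_iff, kernelOp_congr_ae (Lp.coeFn_add f g)]
        exact hk.kernelOp_add_ae (.of_memLp one_le_two (Lp.memLp f))
          (.of_memLp one_le_two (Lp.memLp g))
      map_smul' := fun a f => by
        rw [RingHom.id_apply, ← MemLp.toLp_const_smul, MemLp.toLp_eq_toLp_iff,
          kernelOp_congr_ae (Lp.coeFn_smul a f), kernelOp_smul] }
    c fun f => hk.norm_toLp_kernelOp_le f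

theorem coeFn_toL2 (hk : IsSchurKernel μ k c) (f : Lp 𝕜 2 μ) :
    hk.toL2 𝕜 f =ᵐ[μ] kernelOp μ k f :=
  MemLp.coeFn_toLp (hk.memLp_kernelOp one_le_two (Lp.memLp f))

theorem norm_toL2_le (hk : IsSchurKernel μ k c) (f : Lp 𝕜 2 μ) : ‖hk.toL2 𝕜 f‖ ≤ c * ‖f‖ :=
  (hk.toL2 𝕜).le_of_opNorm_le (LinearMap.mkContinuous_norm_le _ c.2 _) f

end IsSchurKernel

theorem eLpNorm_one_kernelOp [SFinite μ] (hk : Measurable (Function.uncurry k))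
    (hsymm : ∀ x y, k x y = k y x) (hk_nonneg : ∀ x y, 0 ≤ k x y) {F : X → ℝ}
    (hF : AEMeasurable F μ) (hF_nonneg : ∀ x, 0 ≤ F x)
    (hint : ∀ᵐ x ∂μ, Integrable (fun y => k x y * F y) μ) :
    eLpNorm (kernelOp μ k fun y => (F y : 𝕜)) 1 μ =
      ∫⁻ y, (∫⁻ x, ‖k y x‖ₑ ∂μ) * ‖F y‖ₑ ∂μ := by
  have henorm : ∀ᵐ x ∂μ, ‖kernelOp μ k (fun y => (F y : 𝕜)) x‖ₑ =
      ∫⁻ y, ‖k x y‖ₑ * ‖F y‖ₑ ∂μ := by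
    filter_upwards [hint] with x hx
    have hpos (y : X) : 0 ≤ k x y * F y := mul_nonneg (hk_nonneg x y) (hF_nonneg y)
    have hreal : kernelOp μ k (fun y => (F y : 𝕜)) x = ((∫ y, k x y * F y ∂μ : ℝ) : 𝕜) := by
      simp only [kernelOp, ← integral_ofReal, RCLike.real_smul_eq_coe_mul, RCLike.ofReal_mul]
    rw [hreal, ← ofReal_norm, RCLike.norm_ofReal, abs_of_nonneg (integral_nonneg hpos),
      ofReal_integral_eq_lintegral_ofReal hx (Eventually.of_forall hpos)]
    simp_rw [← enorm_mul, Real.enorm_of_nonneg (hpos _)]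
  have hmeas : AEMeasurable (Function.uncurry fun x y => ‖k x y‖ₑ * ‖F y‖ₑ) (μ.prod μ) :=
    hk.enorm.aemeasurable.mul hF.comp_snd.enorm
  rw [eLpNorm_one_eq_lintegral_enorm, lintegral_congr_ae henorm, lintegral_lintegral_swap hmeas]
  simp_rw [fun y x => hsymm x y]
  exact lintegral_congr fun y =>
    lintegral_mul_const _ (hk.comp measurable_prodMk_left).enorm

theorem eLpNorm_one_indicator_lt_kernelOp [SFinite μ] (hk : Measurable (Function.uncurry k))
    (hsymm : ∀ x y, k x y = k y x) (hk_nonneg : ∀ x y, 0 ≤ k x y) {s : Set X}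
    (hs : MeasurableSet s) (hμ : μ s ≠ 0) (hμ_top : μ s ≠ ∞)
    (hint : ∀ᵐ x ∂μ, IntegrableOn (k x) s μ) (hrow : ∀ y ∈ s, 1 < ∫⁻ x, ‖k y x‖ₑ ∂μ) :
    eLpNorm (s.indicator fun _ => (1 : 𝕜)) 1 μ <
      eLpNorm (kernelOp μ k (s.indicator fun _ => (1 : 𝕜))) 1 μ := by
  have hmul (h : X → ℝ) (y : X) : h y * s.indicator (fun _ => (1 : ℝ)) y = s.indicator h y := by
    by_cases hy : y ∈ s <;> simp [hy]
  have hcast : (s.indicator fun _ => (1 : 𝕜)) =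
      fun y => ((s.indicator (fun _ => (1 : ℝ)) y : ℝ) : 𝕜) := by
    funext y
    by_cases hy : y ∈ s <;> simp [hy]
  have hrow_indicator (y : X) : (∫⁻ x, ‖k y x‖ₑ ∂μ) * ‖s.indicator (fun _ => (1 : ℝ)) y‖ₑ =
      s.indicator (fun y => ∫⁻ x, ‖k y x‖ₑ ∂μ) y := by
    by_cases hy : y ∈ s <;> simp [hy]
  have hint_mul : ∀ᵐ x ∂μ, Integrable (fun y => k x y * s.indicator (fun _ => (1 : ℝ)) y) μ := by
    filter_upwards [hint] with x hx
    simpa only [hmul] using hx.integrable_indicator hs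
  have hone : eLpNorm (s.indicator fun _ => (1 : 𝕜)) 1 μ = ∫⁻ _ in s, 1 ∂μ := by
    rw [eLpNorm_indicator_const hs one_ne_zero ENNReal.one_ne_top]
    simp
  rw [hone, hcast, eLpNorm_one_kernelOp hk hsymm hk_nonneg
    (measurable_const.indicator hs).aemeasurable (indicator_nonneg fun _ _ => zero_le_one) hint_mul]
  simp_rw [hrow_indicator]
  rw [lintegral_indicator hs]
  exact setLIntegral_strict_mono hs hμ hk.enorm.lintegral_prod_right' (by simpa using hμ_top)
    (Eventually.of_forall hrow)

end Schur

/-! ### The Bessel semigroup -/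

instance : SigmaFinite halfLine := by
  unfold halfLine
  infer_instance

lemma ae_halfLine_pos : ∀ᵐ x ∂halfLine, 0 < x := ae_restrict_mem measurableSet_Ioi

section Semigroup

variable {α s t : ℝ} {𝕜 : Type*} [RCLike 𝕜]

lemma lintegral_enorm_besselHeatKernel (hα : -1 < α) (ht : 0 < t) {x : ℝ} (hx : 0 < x) :
    ∫⁻ y, ‖besselHeatKernel α t x y‖ₑ ∂halfLine =
      ENNReal.ofReal (auxH (α / 2 + 3 / 4) (α + 1) (x ^ 2 / (4 * t))) := by
  have hnonneg := besselHeatKernel_nonneg hα ht x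
  rw [← integral_besselHeatKernel hα ht hx, ofReal_integral_eq_lintegral_ofReal
    (integrableOn_besselHeatKernel hα ht hx) (Eventually.of_forall hnonneg)]
  exact lintegral_congr fun y => Real.enorm_of_nonneg (hnonneg y)

lemma isSchurKernel_besselHeatKernel (hα : -1 < α) {c : ℝ}
    (hc : ∀ u, 0 < u → auxH (α / 2 + 3 / 4) (α + 1) u ≤ c) (ht : 0 < t) :
    IsSchurKernel halfLine (besselHeatKernel α t) c.toNNReal where
  measurable := measurable_besselHeatKernel hα t
  symm := besselHeatKernel_comm α t
  lintegral_le := by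
    filter_upwards [ae_halfLine_pos] with x hx
    rw [lintegral_enorm_besselHeatKernel hα ht hx]
    exact ENNReal.ofReal_le_ofReal (hc _ (by positivity))

lemma integrable_besselHeatKernel_smul (hα : -1 / 2 ≤ α) (ht : 0 < t) {f : ℝ → 𝕜}
    (hf : MemL1AddLinfty halfLine f) {x : ℝ} (hx : 0 < x) :
    Integrable (fun y => besselHeatKernel α t x y • f y) halfLine := by
  have hα1 : -1 < α := by linarith
  obtain ⟨C, hC⟩ := exists_besselHeatKernel_le hα ht hx
  refine hf.integrable_smul (integrableOn_besselHeatKernel hα1 ht hx) (C := C) ?_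
  filter_upwards [ae_halfLine_pos] with y hy
  rw [Real.norm_of_nonneg (besselHeatKernel_nonneg hα1 ht x y)]
  exact hC y hy

theorem integrable_besselKernel_smul (hα : -1 / 2 ≤ α) (ht : 0 < t) {f : ℝ → 𝕜}
    (hf : MemL1AddLinfty halfLine f) {x : ℝ} (hx : 0 < x) :
    Integrable (fun y => besselKernel α t x y • f y) halfLine := by
  refine (integrable_besselHeatKernel_smul hα ht hf hx).congr ?_
  filter_upwards [ae_halfLine_pos] with y hy
  rw [besselKernel_eq (by linarith) ht hx hy]

lemma besselSemigroup_zero (α : ℝ) (f : ℝ → 𝕜) : besselSemigroup α 0 f = f := if_pos rfl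

lemma besselSemigroup_eq_kernelOp (hα : -1 < α) (ht : 0 < t) (f : ℝ → 𝕜) {x : ℝ} (hx : 0 < x) :
    besselSemigroup α t f x = kernelOp halfLine (besselHeatKernel α t) f x := by
  rw [besselSemigroup, if_neg ht.ne', kernelOp]
  refine integral_congr_ae ?_
  filter_upwards [ae_halfLine_pos] with y hy
  rw [besselKernel_eq hα ht hx hy]

lemma besselSemigroup_ae_eq (hα : -1 < α) (ht : 0 < t) (f : ℝ → 𝕜) :
    besselSemigroup α t f =ᵐ[halfLine] kernelOp halfLine (besselHeatKernel α t) f := by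
  filter_upwards [ae_halfLine_pos] with x hx
  exact besselSemigroup_eq_kernelOp hα ht f hx

theorem besselSemigroup_one (hα : -1 < α) (ht : 0 < t) {x : ℝ} (hx : 0 < x) :
    besselSemigroup α t (fun _ => (1 : 𝕜)) x =
      ((auxH (α / 2 + 3 / 4) (α + 1) (x ^ 2 / (4 * t)) : ℝ) : 𝕜) := by
  rw [besselSemigroup_eq_kernelOp hα ht _ hx, ← integral_besselHeatKernel hα ht hx,
    ← integral_ofReal]
  simp only [kernelOp, RCLike.real_smul_eq_coe_mul, mul_one]
  rfl

theorem memLp_besselSemigroup (hα : -1 < α) {c : ℝ}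
    (hc : ∀ u, 0 < u → auxH (α / 2 + 3 / 4) (α + 1) u ≤ c) (ht : 0 < t) {p : ℝ≥0∞} (hp : 1 ≤ p)
    {f : ℝ → 𝕜} (hf : MemLp f p halfLine) :
    MemLp (besselSemigroup α t f) p halfLine ∧
      eLpNorm (besselSemigroup α t f) p halfLine ≤ ENNReal.ofReal c * eLpNorm f p halfLine := by
  have hk := isSchurKernel_besselHeatKernel hα hc ht
  rw [memLp_congr_ae (besselSemigroup_ae_eq hα ht f),
    eLpNorm_congr_ae (besselSemigroup_ae_eq hα ht f)]
  exact ⟨hk.memLp_kernelOp hp hf, hk.eLpNorm_kernelOp_le hp hf.1⟩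

lemma besselSemigroup_congr_ae {f g : ℝ → 𝕜} (h : f =ᵐ[halfLine] g) :
    besselSemigroup α t f =ᵐ[halfLine] besselSemigroup α t g := by
  rcases eq_or_ne t 0 with rfl | ht
  · simpa only [besselSemigroup_zero] using h
  · simp only [besselSemigroup, if_neg ht]
    exact (kernelOp_congr_ae h).eventuallyEq

lemma integrable_besselHeatKernel_mul_besselHeatKernel (hα : -1 / 2 ≤ α) (hs : 0 < s)
    (ht : 0 < t) {x z : ℝ} (hx : 0 < x) (hz : 0 < z) :
    Integrable (fun y => besselHeatKernel α s x y * besselHeatKernel α t y z) halfLine := by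
  have hα1 : -1 < α := by linarith
  obtain ⟨C, hC⟩ := exists_besselHeatKernel_le hα ht hz
  refine (integrableOn_besselHeatKernel hα1 hs hx).mul_bdd (c := C)
    ((measurable_besselHeatKernel hα1 t).comp measurable_prodMk_right).aestronglyMeasurable ?_
  filter_upwards [ae_halfLine_pos] with y hy
  rw [Real.norm_of_nonneg (besselHeatKernel_nonneg hα1 ht y z), besselHeatKernel_comm]
  exact hC y hy

theorem besselSemigroup_add_time (hα : -1 / 2 ≤ α) (hs : 0 ≤ s) (ht : 0 ≤ t)
    {f : ℝ → 𝕜} (hf : MemL1AddLinfty halfLine f) :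
    besselSemigroup α (s + t) f =ᵐ[halfLine] besselSemigroup α s (besselSemigroup α t f) := by
  have hα1 : -1 < α := by linarith
  rcases hs.eq_or_lt with rfl | hs
  · rw [zero_add, besselSemigroup_zero]
  rcases ht.eq_or_lt with rfl | ht
  · rw [add_zero, besselSemigroup_zero]
  have hst : 0 < s + t := by positivity
  filter_upwards [ae_halfLine_pos] with x hx
  rw [besselSemigroup_eq_kernelOp hα1 hst f hx, besselSemigroup_eq_kernelOp hα1 hs _ hx,
    kernelOp_congr_ae (besselSemigroup_ae_eq hα1 ht f)]
  refine (kernelOp_kernelOp (measurable_besselHeatKernel hα1 s)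
    (measurable_besselHeatKernel hα1 t) (besselHeatKernel_nonneg hα1 hs)
    (besselHeatKernel_nonneg hα1 ht) hf.aestronglyMeasurable ?_ ?_
    (integrable_besselHeatKernel_smul hα hst hf hx)).symm
  · filter_upwards [ae_halfLine_pos] with z hz
    exact integrable_besselHeatKernel_mul_besselHeatKernel hα hs ht hx hz
  · filter_upwards [ae_halfLine_pos] with z hz
    exact integral_besselHeatKernel_mul_besselHeatKernel hα1 hs ht hx hz

lemma exists_isSchurKernel_besselHeatKernel (hα : -1 / 2 ≤ α) :
    ∃ c : NNReal, 1 ≤ c ∧ ∀ t, 0 < t → IsSchurKernel halfLine (besselHeatKernel α t) c := by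
  obtain ⟨c, hc_one, hc⟩ := exists_auxH_bessel_le hα
  exact ⟨c.toNNReal, Real.one_le_toNNReal.2 hc_one.le,
    fun t ht => isSchurKernel_besselHeatKernel (by linarith) hc ht⟩

variable (𝕜) in
/-- The heat operator at time `t` as a bounded operator on `L²(0, ∞)`; the identity for `t ≤ 0`. -/
def heatL2 (hα : -1 / 2 ≤ α) (t : ℝ) : Lp 𝕜 2 halfLine →L[𝕜] Lp 𝕜 2 halfLine :=
  if ht : 0 < t then
    ((exists_isSchurKernel_besselHeatKernel hα).choose_spec.2 t ht).toL2 𝕜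
  else ContinuousLinearMap.id 𝕜 _

lemma coeFn_heatL2 (hα : -1 / 2 ≤ α) (ht : 0 ≤ t) (u : Lp 𝕜 2 halfLine) :
    heatL2 𝕜 hα t u =ᵐ[halfLine] besselSemigroup α t u := by
  rcases ht.eq_or_lt with rfl | ht
  · rw [heatL2, dif_neg (lt_irrefl _), besselSemigroup_zero, ContinuousLinearMap.id_apply]
  · rw [heatL2, dif_pos ht]
    exact (IsSchurKernel.coeFn_toL2 _ u).trans (besselSemigroup_ae_eq (by linarith) ht _).symm

lemma coeFn_heatL2_toLp (hα : -1 / 2 ≤ α) (ht : 0 ≤ t) {f : ℝ → 𝕜} (hf : MemLp f 2 halfLine) :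
    heatL2 𝕜 hα t (hf.toLp f) =ᵐ[halfLine] besselSemigroup α t f :=
  (coeFn_heatL2 hα ht _).trans (besselSemigroup_congr_ae hf.coeFn_toLp)

lemma exists_norm_heatL2_le (hα : -1 / 2 ≤ α) :
    ∃ c : NNReal, ∀ t u, ‖heatL2 𝕜 hα t u‖ ≤ c * ‖u‖ := by
  refine ⟨(exists_isSchurKernel_besselHeatKernel hα).choose, fun t u => ?_⟩
  have hc := (exists_isSchurKernel_besselHeatKernel hα).choose_spec.1
  by_cases ht : 0 < t
  · rw [heatL2, dif_pos ht]
    exact IsSchurKernel.norm_toL2_le _ u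
  · rw [heatL2, dif_neg ht]
    exact le_mul_of_one_le_left (norm_nonneg u) (NNReal.one_le_coe.2 hc)

end Semigroup

/-! ### Strong continuity -/

/-- The functions `x ^ (α + 1/2) exp (-a x ^ 2)`, which the heat semigroup permutes up to a scalar
factor. -/
def besselGauss (α a x : ℝ) : ℝ := x ^ (α + 1 / 2) * Real.exp (-a * x ^ 2)

section Gauss

variable {α a b t : ℝ} {𝕜 : Type*} [RCLike 𝕜]

lemma besselGauss_mul_besselGauss {x : ℝ} (hx : 0 < x) :
    besselGauss α a x * besselGauss α b x = x ^ (2 * α + 1) * Real.exp (-(a + b) * x ^ 2) := by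
  rw [besselGauss, besselGauss, show 2 * α + 1 = (α + 1 / 2) + (α + 1 / 2) by ring,
    Real.rpow_add hx (α + 1 / 2) (α + 1 / 2), neg_add, add_mul, Real.exp_add]
  ring

lemma measurable_besselGauss (α a : ℝ) : Measurable (besselGauss α a) := by
  unfold besselGauss
  fun_prop

lemma memLp_besselGauss (hα : -1 < α) (ha : 0 < a) :
    MemLp (fun x => (besselGauss α a x : 𝕜)) 2 halfLine := by
  refine MemLp.ofReal ((memLp_two_iff_integrable_sq
    (measurable_besselGauss α a).aestronglyMeasurable).2 ?_)
  refine Integrable.congr (integrableOn_rpow_mul_exp_neg_mul_sq (b := a + a) (by positivity)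
    (show -1 < 2 * α + 1 by linarith)) ?_
  filter_upwards [ae_halfLine_pos] with x hx
  exact (besselGauss_mul_besselGauss hx).symm.trans (sq _).symm

variable (𝕜) in
/-- `besselGauss α a` as an element of `L²(0, ∞)`. -/
def besselGaussL2 (hα : -1 < α) (ha : 0 < a) : Lp 𝕜 2 halfLine :=
  (memLp_besselGauss hα ha).toLp fun x => (besselGauss α a x : 𝕜)

lemma coeFn_besselGaussL2 (hα : -1 < α) (ha : 0 < a) :
    besselGaussL2 𝕜 hα ha =ᵐ[halfLine] fun x => (besselGauss α a x : 𝕜) :=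
  MemLp.coeFn_toLp _

lemma integral_besselGauss_mul_besselGauss (hα : -1 < α) (ha : 0 < a) (hb : 0 < b) :
    ∫ x, besselGauss α a x * besselGauss α b x ∂halfLine =
      (a + b) ^ (-(α + 1)) * Real.Gamma (α + 1) / 2 := by
  have h := integral_rpow_mul_exp_neg_mul_sq (p := a + b) (by positivity)
    (show -1 < 2 * α + 1 by linarith)
  rw [show (2 * α + 1 + 1) / 2 = α + 1 by ring] at h
  rw [← h]
  exact setIntegral_congr_fun measurableSet_Ioi fun x hx => besselGauss_mul_besselGauss hx

lemma inner_besselGaussL2 (hα : -1 < α) (ha : 0 < a) (hb : 0 < b) :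
    inner 𝕜 (besselGaussL2 𝕜 hα ha) (besselGaussL2 𝕜 hα hb) =
      (((a + b) ^ (-(α + 1)) * Real.Gamma (α + 1) / 2 : ℝ) : 𝕜) := by
  rw [← integral_besselGauss_mul_besselGauss hα ha hb, ← integral_ofReal, L2.inner_def]
  refine integral_congr_ae ?_
  filter_upwards [coeFn_besselGaussL2 (𝕜 := 𝕜) hα ha,
    coeFn_besselGaussL2 (𝕜 := 𝕜) hα hb] with x hxa hxb
  rw [hxa, hxb, RCLike.inner_apply, RCLike.conj_ofReal, mul_comm, ← RCLike.ofReal_mul]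

lemma norm_smul_besselGaussL2_sub_sq (hα : -1 < α) (ha : 0 < a) (hb : 0 < b) (r : ℝ) :
    ‖(r : 𝕜) • besselGaussL2 𝕜 hα hb - besselGaussL2 𝕜 hα ha‖ ^ 2 =
      (r ^ 2 * (b + b) ^ (-(α + 1)) - 2 * r * (b + a) ^ (-(α + 1)) + (a + a) ^ (-(α + 1))) *
        (Real.Gamma (α + 1) / 2) := by
  have hnorm {d : ℝ} (hd : 0 < d) :
      ‖besselGaussL2 𝕜 hα hd‖ ^ 2 = (d + d) ^ (-(α + 1)) * Real.Gamma (α + 1) / 2 := by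
    rw [← inner_self_eq_norm_sq (𝕜 := 𝕜), inner_besselGaussL2 (𝕜 := 𝕜), RCLike.ofReal_re]
  rw [norm_sub_sq (𝕜 := 𝕜), inner_smul_left, norm_smul, mul_pow, hnorm, hnorm,
    inner_besselGaussL2, RCLike.conj_ofReal, ← RCLike.ofReal_mul, RCLike.ofReal_re,
    RCLike.norm_ofReal, sq_abs]
  ring

lemma integral_besselHeatKernel_mul_besselGauss (hα : -1 < α) (ht : 0 < t) (ha : 0 < a) {x : ℝ}
    (hx : 0 < x) :
    ∫ y, besselHeatKernel α t x y * besselGauss α a y ∂halfLine =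
      (1 + 4 * a * t)⁻¹ ^ (α + 1) * besselGauss α (a * (1 + 4 * a * t)⁻¹) x := by
  have hscale : (1 + 4 * a * t)⁻¹ = (4 * t)⁻¹ / ((4 * t)⁻¹ + a) := by
    field_simp
  rw [hscale]
  have hq : 0 < (4 * t)⁻¹ := by positivity
  have hkernel (y : ℝ) (hy : 0 < y) : besselHeatKernel α t x y * besselGauss α a y =
      2 * (4 * t)⁻¹ ^ (α + 1) * x ^ (α + 1 / 2) * Real.exp (-(4 * t)⁻¹ * x ^ 2) *
        (y ^ (2 * α + 1) * Real.exp (-((4 * t)⁻¹ + a) * y ^ 2) *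
          besselClifford α (((4 * t)⁻¹ * x) ^ 2 * y ^ 2)) := by
    rw [besselHeatKernel, besselGauss, abs_of_pos (mul_pos hx hy), Real.mul_rpow hx.le hy.le,
      show 2 * α + 1 = (α + 1 / 2) + (α + 1 / 2) by ring, Real.rpow_add hy (α + 1 / 2) (α + 1 / 2),
      mul_add, Real.exp_add, neg_add, add_mul, Real.exp_add, mul_pow _ y]
    ring
  generalize (4 * t)⁻¹ = q at *
  have hweber : ∫ y in Ioi 0, y ^ (2 * α + 1) * Real.exp (-(q + a) * y ^ 2) *
      besselClifford α ((q * x) ^ 2 * y ^ 2) =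
        (q + a) ^ (-(α + 1)) / 2 * Real.exp ((q * x) ^ 2 / (q + a)) := by
    have hGamma : Real.Gamma (α + 1) ≠ 0 := (Real.Gamma_pos_of_pos (by linarith)).ne'
    simpa [laguerreNeg, hGamma] using
      integral_rpow_mul_gaussian_mul_besselClifford hα (add_pos hq ha) ((q * x) ^ 2) 0
  have hexp : Real.exp (-q * x ^ 2) * Real.exp ((q * x) ^ 2 / (q + a)) =
      Real.exp (-(a * (q / (q + a))) * x ^ 2) := by
    rw [← Real.exp_add]
    congr 1
    field_simp
    ring
  rw [halfLine, setIntegral_congr_fun measurableSet_Ioi hkernel, integral_const_mul, hweber,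
    besselGauss, ← hexp, Real.div_rpow hq.le (by positivity), Real.rpow_neg (by positivity)]
  ring

lemma heatL2_besselGaussL2 (hα : -1 / 2 ≤ α) (hα1 : -1 < α) (ht : 0 < t) (ha : 0 < a)
    (hb : 0 < a * (1 + 4 * a * t)⁻¹) :
    heatL2 𝕜 hα t (besselGaussL2 𝕜 hα1 ha) =
      (((1 + 4 * a * t)⁻¹ ^ (α + 1) : ℝ) : 𝕜) • besselGaussL2 𝕜 hα1 hb := by
  refine Lp.ext ((coeFn_heatL2_toLp hα ht.le _).trans ?_)
  filter_upwards [ae_halfLine_pos, coeFn_besselGaussL2 (𝕜 := 𝕜) hα1 hb, Lp.coeFn_smul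
    (((1 + 4 * a * t)⁻¹ ^ (α + 1) : ℝ) : 𝕜) (besselGaussL2 𝕜 hα1 hb)] with x hx hgauss hsmul
  rw [hsmul, Pi.smul_apply, hgauss, smul_eq_mul, ← RCLike.ofReal_mul,
    ← integral_besselHeatKernel_mul_besselGauss hα1 ht ha hx, ← integral_ofReal,
    besselSemigroup_eq_kernelOp hα1 ht _ hx]
  simp only [kernelOp, RCLike.real_smul_eq_coe_mul, RCLike.ofReal_mul]

lemma tendsto_heatL2_besselGaussL2 (hα : -1 / 2 ≤ α) (hα1 : -1 < α) (ha : 0 < a) :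
    Tendsto (fun t => heatL2 𝕜 hα t (besselGaussL2 𝕜 hα1 ha)) (𝓝[>] 0)
      (𝓝 (besselGaussL2 𝕜 hα1 ha)) := by
  rw [tendsto_iff_norm_sub_tendsto_zero]
  let F (l : ℝ) : ℝ := ((l ^ (α + 1)) ^ 2 * (a * l + a * l) ^ (-(α + 1)) -
    2 * l ^ (α + 1) * (a * l + a) ^ (-(α + 1)) + (a + a) ^ (-(α + 1))) * (Real.Gamma (α + 1) / 2)
  have hF_one : F 1 = 0 := by
    simp only [F, Real.one_rpow]
    ring_nf
  have hF : ContinuousAt F 1 := by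
    have hpow : ContinuousAt (fun l : ℝ => l ^ (α + 1)) 1 :=
      Real.continuousAt_rpow_const _ _ (Or.inl one_ne_zero)
    have hpow_same : ContinuousAt (fun l : ℝ => (a * l + a * l) ^ (-(α + 1))) 1 :=
      ContinuousAt.rpow_const (by fun_prop) (Or.inl (by positivity))
    have hpow_mixed : ContinuousAt (fun l : ℝ => (a * l + a) ^ (-(α + 1))) 1 :=
      ContinuousAt.rpow_const (by fun_prop) (Or.inl (by positivity))
    unfold F
    fun_prop
  have hscale : Tendsto (fun t : ℝ => (1 + 4 * a * t)⁻¹) (𝓝[>] 0) (𝓝 1) := by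
    have hcont : ContinuousAt (fun t : ℝ => (1 + 4 * a * t)⁻¹) 0 := by
      fun_prop (disch := simp)
    simpa using hcont.tendsto.mono_left nhdsWithin_le_nhds
  have hlim : Tendsto (fun t => √(F (1 + 4 * a * t)⁻¹)) (𝓝[>] 0) (𝓝 0) := by
    simpa only [hF_one, Real.sqrt_zero, Function.comp_apply] using (hF.tendsto.comp hscale).sqrt
  refine hlim.congr' ?_
  filter_upwards [self_mem_nhdsWithin] with t (ht : 0 < t)
  have hb : 0 < a * (1 + 4 * a * t)⁻¹ := by positivity
  rw [← Real.sqrt_sq (norm_nonneg _), heatL2_besselGaussL2 hα hα1 ht ha hb,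
    norm_smul_besselGaussL2_sub_sq]

end Gauss

section Density

theorem integral_comp_smul_eq_zero_of_forall_pow {X E : Type*} [MeasurableSpace X]
    [NormedAddCommGroup E] [NormedSpace ℝ E] {μ : Measure X} {φ : X → ℝ} {w : X → E}
    (hφ : AEStronglyMeasurable φ μ) (hφ_mem : ∀ x, φ x ∈ Icc 0 1) (hw : Integrable w μ)
    (h : ∀ n : ℕ, ∫ x, φ x ^ n • w x ∂μ = 0) {g : ℝ → ℝ} (hg : Continuous g) :
    ∫ x, g (φ x) • w x ∂μ = 0 := by
  have hint {G : ℝ → ℝ} (hG : Continuous G) : Integrable (fun x => G (φ x) • w x) μ := by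
    obtain ⟨C, hC⟩ := isCompact_Icc.exists_bound_of_continuousOn (s := Icc 0 1) hG.continuousOn
    exact hw.bdd_smul C (hG.comp_aestronglyMeasurable hφ)
      (Eventually.of_forall fun x => hC _ (hφ_mem x))
  have hpoly (P : Polynomial ℝ) : ∫ x, P.eval (φ x) • w x ∂μ = 0 := by
    have hterm (n : ℕ) : Integrable (fun x => P.coeff n • φ x ^ n • w x) μ :=
      (hint (continuous_pow n)).smul (P.coeff n)
    simp only [Polynomial.eval_eq_sum_range, Finset.sum_smul, mul_smul]
    rw [integral_finsetSum _ fun n _ => hterm n]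
    simp_rw [integral_smul, h, smul_zero, Finset.sum_const_zero]
  have hle (ε : ℝ) (hε : 0 < ε) : ‖∫ x, g (φ x) • w x ∂μ‖ ≤ ε * ∫ x, ‖w x‖ ∂μ := by
    obtain ⟨P, hP⟩ := exists_polynomial_near_of_continuousOn 0 1 g hg.continuousOn ε hε
    rw [← sub_zero (∫ x, g (φ x) • w x ∂μ), ← hpoly P, ← integral_sub (hint hg)
      (hint P.continuous), ← integral_const_mul]
    refine norm_integral_le_of_norm_le (hw.norm.const_mul ε) (Eventually.of_forall fun x => ?_)
    rw [← sub_smul, norm_smul, norm_sub_rev]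
    gcongr
    exact (hP _ (hφ_mem x)).le
  have hlim : Tendsto (fun ε : ℝ => ε * ∫ x, ‖w x‖ ∂μ) (𝓝[>] 0) (𝓝 0) :=
    ((continuous_mul_const _).tendsto' 0 0 (zero_mul _)).mono_left nhdsWithin_le_nhds
  exact norm_le_zero_iff.1 (ge_of_tendsto hlim (eventually_mem_nhdsWithin.mono hle))

lemma continuous_comp_sqrt_neg_log {χ : ℝ → ℝ} (hχ : Continuous χ) (hsupp : HasCompactSupport χ)
    (hzero : χ 0 = 0) : Continuous fun y => χ (√(-Real.log y)) := by
  rw [continuous_iff_continuousAt]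
  intro y
  rcases eq_or_ne y 0 with rfl | hy
  · rw [continuousAt_iff_punctured_nhds, Real.log_zero, neg_zero, Real.sqrt_zero, hzero]
    exact (hsupp.is_zero_at_infty.mono_left atTop_le_cocompact).comp
      (Real.tendsto_sqrt_atTop.comp (tendsto_neg_atBot_atTop.comp Real.tendsto_log_nhdsNE_zero))
  · exact hχ.continuousAt.comp (Real.continuousAt_log hy).neg.sqrt

variable {𝕜 : Type*} [RCLike 𝕜]

theorem ae_eq_zero_of_forall_integral_exp_neg_mul_sq {w : ℝ → 𝕜} (hw : Integrable w halfLine)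
    (h : ∀ n : ℕ, ∫ x, Real.exp (-n * x ^ 2) • w x ∂halfLine = 0) : w =ᵐ[halfLine] 0 := by
  refine (ae_restrict_iff' measurableSet_Ioi).2
    (isOpen_Ioi.ae_eq_zero_of_integral_contDiff_smul_eq_zero
      (IntegrableOn.locallyIntegrableOn hw) fun χ hχ hsupp hsub => ?_)
  have hzero : ∀ x, x ∉ Ioi (0 : ℝ) → χ x = 0 := fun x hx =>
    image_eq_zero_of_notMem_tsupport fun hmem => hx (hsub hmem)
  have hcont := continuous_comp_sqrt_neg_log hχ.continuous hsupp (hzero 0 self_notMem_Ioi)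
  have hpow (n : ℕ) (x : ℝ) : Real.exp (-x ^ 2) ^ n = Real.exp (-n * x ^ 2) := by
    rw [← Real.exp_nat_mul, mul_neg, neg_mul]
  have hmem (x : ℝ) : Real.exp (-x ^ 2) ∈ Icc (0 : ℝ) 1 :=
    ⟨(Real.exp_pos _).le, Real.exp_le_one_iff.2 (by nlinarith [sq_nonneg x])⟩
  have hχ_comp := integral_comp_smul_eq_zero_of_forall_pow (by fun_prop) hmem hw
    (fun n => by simpa only [hpow] using h n) hcont
  calc ∫ x, χ x • w x = ∫ x, χ x • w x ∂halfLine :=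
        (setIntegral_eq_integral_of_forall_compl_eq_zero
          fun x hx => by rw [hzero x hx, zero_smul]).symm
    _ = ∫ x, χ (√(-Real.log (Real.exp (-x ^ 2)))) • w x ∂halfLine :=
        setIntegral_congr_fun measurableSet_Ioi fun x (hx : 0 < x) => by
          simp only [Real.log_exp, neg_neg, Real.sqrt_sq hx.le]
    _ = 0 := hχ_comp

variable {α : ℝ}

lemma eq_zero_of_forall_inner_besselGaussL2 (hα : -1 < α) {v : Lp 𝕜 2 halfLine}
    (h : ∀ (a : ℝ) (ha : 0 < a), inner 𝕜 (besselGaussL2 𝕜 hα ha) v = 0) : v = 0 := by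
  have hint : Integrable (fun x => besselGauss α 1 x • v x) halfLine := by
    simp only [RCLike.real_smul_eq_coe_mul]
    exact (memLp_besselGauss hα one_pos).integrable_mul (Lp.memLp v)
  have hzero := ae_eq_zero_of_forall_integral_exp_neg_mul_sq hint fun n => by
    have ha : (0 : ℝ) < 1 + n := by positivity
    rw [← h _ ha, L2.inner_def]
    refine integral_congr_ae ?_
    filter_upwards [coeFn_besselGaussL2 (𝕜 := 𝕜) hα ha] with x hx
    rw [hx, RCLike.inner_apply, RCLike.conj_ofReal, smul_smul, RCLike.real_smul_eq_coe_mul,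
      mul_comm, besselGauss, besselGauss, neg_add, add_mul, Real.exp_add]
    congr 2
    ring
  refine Lp.ext ?_
  filter_upwards [hzero, ae_halfLine_pos, Lp.coeFn_zero 𝕜 2 halfLine] with x hx hpos hx_zero
  have hgauss : besselGauss α 1 x ≠ 0 := by
    unfold besselGauss
    positivity
  rw [hx_zero]
  simpa [hgauss] using hx

theorem tendsto_heatL2 (hα : -1 / 2 ≤ α) (u : Lp 𝕜 2 halfLine) :
    Tendsto (fun t => heatL2 𝕜 hα t u) (𝓝[>] 0) (𝓝 u) := by
  have hα1 : -1 < α := by linarith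
  obtain ⟨c, hc⟩ := exists_norm_heatL2_le (𝕜 := 𝕜) hα
  let K : Submodule 𝕜 (Lp 𝕜 2 halfLine) :=
    { carrier := {v | Tendsto (fun t => heatL2 𝕜 hα t v) (𝓝[>] 0) (𝓝 v)}
      add_mem' := fun {v w} hv hw => by simpa only [mem_ofPred_eq, map_add] using hv.add hw
      zero_mem' := by simpa only [mem_ofPred_eq, map_zero] using tendsto_const_nhds
      smul_mem' := fun a v hv => by simpa only [mem_ofPred_eq, map_smul] using hv.const_smul a }
  have hequi : Equicontinuous fun t => ⇑(heatL2 𝕜 hα t) :=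
    (LipschitzWith.uniformEquicontinuous _ c fun t =>
      AddMonoidHomClass.lipschitz_of_bound_nnnorm (heatL2 𝕜 hα t) c (hc t)).equicontinuous
  have hclosed : IsClosed (K : Set (Lp 𝕜 2 halfLine)) :=
    hequi.isClosed_setOfPred_tendsto continuous_id
  have htop : K.topologicalClosure = ⊤ := by
    rw [Submodule.topologicalClosure_eq_top_iff, Submodule.eq_bot_iff]
    intro v hv
    exact eq_zero_of_forall_inner_besselGaussL2 hα1 fun a ha =>
      (Submodule.mem_orthogonal K v).1 hv _ (tendsto_heatL2_besselGaussL2 hα hα1 ha)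
  have hmem : u ∈ K.topologicalClosure := htop ▸ Submodule.mem_top
  rwa [hclosed.submodule_topologicalClosure_eq] at hmem

theorem tendsto_eLpNorm_besselSemigroup (hα : -1 / 2 ≤ α) {f : ℝ → 𝕜}
    (hf : MemLp f 2 halfLine) :
    Tendsto (fun t => eLpNorm (besselSemigroup α t f - f) 2 halfLine) (𝓝[>] 0) (𝓝 0) := by
  refine ((Lp.tendsto_Lp_iff_tendsto_eLpNorm' _ _).1 (tendsto_heatL2 hα (hf.toLp f))).congr' ?_
  filter_upwards [self_mem_nhdsWithin] with t (ht : 0 < t)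
  exact eLpNorm_congr_ae ((coeFn_heatL2_toLp hα ht.le hf).sub hf.coeFn_toLp)

end Density

/-! ### The Hankel transform of compactly supported functions -/

section Gaussian

variable {E : Type*} [NormedAddCommGroup E] [NormedSpace ℝ E] {μ : Measure ℝ} {t : ℝ}

lemma norm_exp_neg_mul_sq_le_one (ht : 0 ≤ t) (l : ℝ) : ‖Real.exp (-t * l ^ 2)‖ ≤ 1 := by
  rw [Real.norm_of_nonneg (Real.exp_pos _).le, Real.exp_le_one_iff, neg_mul, neg_nonpos]
  positivity

theorem tendsto_integral_exp_neg_mul_sq_smul {F : ℝ → E} (hF : Integrable F μ) :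
    Tendsto (fun t : ℝ => ∫ l, Real.exp (-t * l ^ 2) • F l ∂μ) (𝓝[>] 0) (𝓝 (∫ l, F l ∂μ)) := by
  refine tendsto_integral_filter_of_dominated_convergence (fun l => ‖F l‖)
    (Eventually.of_forall fun t => ?_) ?_ hF.norm (Eventually.of_forall fun l => ?_)
  · exact (by fun_prop : Measurable fun l : ℝ => Real.exp (-t * l ^ 2)).aestronglyMeasurable.smul
      hF.1
  · filter_upwards [self_mem_nhdsWithin] with t (ht : 0 < t)
    refine Eventually.of_forall fun l => ?_
    rw [norm_smul]
    exact mul_le_of_le_one_left (norm_nonneg _) (norm_exp_neg_mul_sq_le_one ht.le l)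
  · have hcont : Continuous fun t : ℝ => Real.exp (-t * l ^ 2) • F l := by fun_prop
    exact (hcont.tendsto' 0 _ (by simp)).mono_left nhdsWithin_le_nhds

theorem lintegral_le_of_forall_lintegral_exp_neg_mul_sq_mul_le {F : ℝ → ℝ≥0∞}
    (hF : AEMeasurable F μ) {B : ℝ≥0∞}
    (h : ∀ t : ℝ, 0 < t → ∫⁻ l, ENNReal.ofReal (Real.exp (-t * l ^ 2)) * F l ∂μ ≤ B) :
    ∫⁻ l, F l ∂μ ≤ B := by
  have hlim (l : ℝ) : Tendsto (fun t : ℝ => ENNReal.ofReal (Real.exp (-t * l ^ 2)) * F l)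
      (𝓝[>] 0) (𝓝 (F l)) := by
    have hcont : Continuous fun t : ℝ => ENNReal.ofReal (Real.exp (-t * l ^ 2)) :=
      ENNReal.continuous_ofReal.comp (by fun_prop)
    have hone := (hcont.tendsto' 0 1 (by simp)).mono_left (nhdsWithin_le_nhds (s := Ioi 0))
    simpa only [one_mul] using ENNReal.Tendsto.mul_const hone (Or.inl one_ne_zero)
  have hle : ∀ᶠ t in 𝓝[>] (0 : ℝ), ∫⁻ l, ENNReal.ofReal (Real.exp (-t * l ^ 2)) * F l ∂μ ≤ B := by
    filter_upwards [self_mem_nhdsWithin] with t ht using h t ht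
  calc ∫⁻ l, F l ∂μ
      = ∫⁻ l, liminf (fun t : ℝ => ENNReal.ofReal (Real.exp (-t * l ^ 2)) * F l)
          (𝓝[>] (0 : ℝ)) ∂μ := by
        simp_rw [fun l => (hlim l).liminf_eq]
    _ ≤ liminf (fun t : ℝ => ∫⁻ l, ENNReal.ofReal (Real.exp (-t * l ^ 2)) * F l ∂μ)
          (𝓝[>] (0 : ℝ)) := lintegral_liminf_le' fun t => by fun_prop
    _ ≤ B := liminf_le_of_frequently_le' hle.frequently

end Gaussian

/-- `f ∈ L²(0, ∞)` vanishes outside `(0, R)`. For such `f` the Hankel transform is given by an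
absolutely convergent integral. -/
structure MemL2Ioo {𝕜 : Type*} [RCLike 𝕜] (R : ℝ) (f : ℝ → 𝕜) : Prop where
  memLp : MemLp f 2 halfLine
  eq_zero : ∀ x, x ∉ Ioo 0 R → f x = 0

/-- The Hankel transform of order `α` of a function with bounded support, as an absolutely
convergent integral. -/
def besselHankel {𝕜 : Type*} [RCLike 𝕜] (α : ℝ) (f : ℝ → 𝕜) : ℝ → 𝕜 :=
  kernelOp halfLine (fun l x => besselEven α (l * x)) f

section BoundedSupport

variable {α t R S : ℝ} {𝕜 : Type*} [RCLike 𝕜] {f g : ℝ → 𝕜}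

lemma hasExpGrowth_besselEven (hα : -1 / 2 ≤ α) : HasExpGrowth (besselEven α) := by
  obtain ⟨C, b, h⟩ := (HasExpGrowth.rpow (show 0 ≤ α + 1 / 2 by linarith)).mul
    (HasExpGrowth.besselClifford_mul_sq (show -1 < α by linarith) (-1 / 4))
  refine ⟨2 ^ (-α) * C, b, fun x hx => ?_⟩
  rw [besselEven, abs_of_pos hx, mul_assoc, abs_mul, abs_of_pos (by positivity), mul_assoc]
  gcongr
  exact h x hx

namespace MemL2Ioo

lemma mono (hf : MemL2Ioo R f) (hRS : R ≤ S) : MemL2Ioo S f :=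
  ⟨hf.memLp, fun x hx => hf.eq_zero x fun hmem => hx ⟨hmem.1, hmem.2.trans_le hRS⟩⟩

lemma sub (hf : MemL2Ioo R f) (hg : MemL2Ioo R g) : MemL2Ioo R (f - g) :=
  ⟨hf.memLp.sub hg.memLp, fun x hx => by
    rw [Pi.sub_apply, hf.eq_zero x hx, hg.eq_zero x hx, sub_zero]⟩

lemma integrable (hf : MemL2Ioo R f) : Integrable f halfLine := by
  have hone : MemLp ((Ioo 0 R).indicator fun _ => (1 : 𝕜)) 2 halfLine :=
    memLp_indicator_const 2 measurableSet_Ioo 1 (Or.inr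
      (((Measure.restrict_apply_le _ _).trans_lt measure_Ioo_lt_top).ne))
  refine (MemLp.integrable_mul hone hf.memLp).congr (Eventually.of_forall fun x => ?_)
  by_cases hx : x ∈ Ioo 0 R
  · simp [hx]
  · simp [hf.eq_zero x hx]

lemma exists_norm_besselEven_smul_le (hα : -1 / 2 ≤ α) (R : ℝ) :
    ∃ C b, ∀ f : ℝ → 𝕜, MemL2Ioo R f → ∀ l, 0 < l → ∀ x,
      ‖besselEven α (l * x) • f x‖ ≤ C * Real.exp (b * l) * ‖f x‖ := by
  obtain ⟨C, b, h⟩ := hasExpGrowth_besselEven hα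
  have hC : 0 ≤ C := nonneg_of_mul_nonneg_left ((abs_nonneg _).trans (h 1 one_pos)) (Real.exp_pos _)
  refine ⟨C, |b| * R, fun f hf l hl x => ?_⟩
  by_cases hx : x ∈ Ioo 0 R
  · rw [norm_smul, Real.norm_eq_abs]
    gcongr
    refine (h _ (mul_pos hl hx.1)).trans (mul_le_mul_of_nonneg_left (Real.exp_le_exp.2 ?_) hC)
    calc b * (l * x) ≤ |b| * (l * R) := by
          have := hx.1
          gcongr
          exacts [le_abs_self b, hx.2.le]
      _ = |b| * R * l := by ring
  · simp [hf.eq_zero x hx]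

lemma integrable_besselEven_smul (hα : -1 / 2 ≤ α) (hf : MemL2Ioo R f) {l : ℝ} (hl : 0 < l) :
    Integrable (fun x => besselEven α (l * x) • f x) halfLine := by
  obtain ⟨C, b, h⟩ := exists_norm_besselEven_smul_le (𝕜 := 𝕜) hα R
  have hmeas := (continuous_besselEven hα).measurable
  exact (hf.integrable.norm.const_mul (C * Real.exp (b * l))).mono'
    ((by fun_prop : Measurable fun x => besselEven α (l * x)).aestronglyMeasurable.smul hf.memLp.1)
    (Eventually.of_forall fun x => h f hf l hl x)

lemma besselHankel_sub (hα : -1 / 2 ≤ α) (hf : MemL2Ioo R f) (hg : MemL2Ioo S g) :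
    besselHankel α (f - g) =ᵐ[halfLine] besselHankel α f - besselHankel α g := by
  filter_upwards [ae_halfLine_pos] with l hl
  simp only [besselHankel, kernelOp, Pi.sub_apply, smul_sub]
  exact integral_sub (hf.integrable_besselEven_smul hα hl) (hg.integrable_besselEven_smul hα hl)

end MemL2Ioo

lemma measurable_besselEven_mul (hα : -1 / 2 ≤ α) :
    Measurable (Function.uncurry fun l x : ℝ => besselEven α (l * x)) :=
  (continuous_besselEven hα).measurable.comp (measurable_fst.mul measurable_snd)

lemma aestronglyMeasurable_besselHankel (hα : -1 / 2 ≤ α) (hf : AEStronglyMeasurable f halfLine) :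
    AEStronglyMeasurable (besselHankel α f) halfLine :=
  aestronglyMeasurable_kernelOp (measurable_besselEven_mul hα) hf

lemma integral_exp_mul_besselEven_mul_besselEven (hα : -1 < α) (ht : 0 < t) {x y : ℝ}
    (hx : 0 < x) (hy : 0 < y) :
    ∫ l, Real.exp (-t * l ^ 2) * besselEven α (l * x) * besselEven α (l * y) ∂halfLine =
      besselHeatKernel α t x y := by
  rw [← besselKernel_eq hα ht hx hy, besselKernel]
  refine setIntegral_congr_fun measurableSet_Ioi fun l hl => ?_
  rw [besselPsi_eq_besselEven hl hx, besselPsi_eq_besselEven hl hy]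

lemma integrable_exp_neg_mul_sq_mul_exp (ht : 0 < t) (b : ℝ) :
    Integrable (fun l : ℝ => Real.exp (-t * l ^ 2) * Real.exp (b * l)) halfLine := by
  have hgrowth : HasExpGrowth fun l => Real.exp (b * l) :=
    ⟨1, b, fun l _ => by rw [Real.abs_exp, one_mul]⟩
  have hint := hgrowth.integrableOn_gaussian_mul (by fun_prop) ht (show (-1 : ℝ) < 0 by norm_num)
  simp only [Real.rpow_zero, one_mul] at hint
  exact hint

lemma integrable_exp_smul_inner_besselEven_smul (hα : -1 / 2 ≤ α) (ht : 0 < t)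
    (hf : MemL2Ioo R f) (hg : MemL2Ioo R g) :
    Integrable (fun q : ℝ × ℝ × ℝ => Real.exp (-t * q.1 ^ 2) •
      inner 𝕜 (besselEven α (q.1 * q.2.2) • f q.2.2) (besselEven α (q.1 * q.2.1) • g q.2.1))
      (halfLine.prod (halfLine.prod halfLine)) := by
  obtain ⟨C, b, h⟩ := MemL2Ioo.exists_norm_besselEven_smul_le (𝕜 := 𝕜) hα R
  have hdom := (integrable_exp_neg_mul_sq_mul_exp ht (b + b)).mul_prod
    ((hg.integrable.norm.mul_prod hf.integrable.norm).const_mul (C * C))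
  have hmeas := (continuous_besselEven hα).measurable
  refine hdom.mono' ?_ ?_
  · exact (by fun_prop : Measurable fun q : ℝ × ℝ × ℝ =>
      Real.exp (-t * q.1 ^ 2)).aestronglyMeasurable.smul
      (((by fun_prop : Measurable fun q : ℝ × ℝ × ℝ =>
        besselEven α (q.1 * q.2.2)).aestronglyMeasurable.smul hf.memLp.1.comp_snd.comp_snd).inner
      ((by fun_prop : Measurable fun q : ℝ × ℝ × ℝ =>
        besselEven α (q.1 * q.2.1)).aestronglyMeasurable.smul hg.memLp.1.comp_fst.comp_snd))
  · filter_upwards [Measure.quasiMeasurePreserving_fst.ae ae_halfLine_pos] with ⟨l, x, y⟩ hl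
    rw [norm_smul, Real.norm_of_nonneg (Real.exp_pos _).le]
    calc Real.exp (-t * l ^ 2) *
          ‖inner 𝕜 (besselEven α (l * y) • f y) (besselEven α (l * x) • g x)‖
        ≤ Real.exp (-t * l ^ 2) * ((C * Real.exp (b * l) * ‖f y‖) *
          (C * Real.exp (b * l) * ‖g x‖)) := by
          gcongr
          exact (norm_inner_le_norm _ _).trans (mul_le_mul (h f hf l hl y) (h g hg l hl x)
            (norm_nonneg _) ((norm_nonneg _).trans (h f hf l hl y)))
      _ = Real.exp (-t * l ^ 2) * Real.exp ((b + b) * l) * (C * C * (‖g x‖ * ‖f y‖)) := by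
          rw [add_mul, Real.exp_add]
          ring

lemma inner_besselHankel_eq_integral (l : ℝ) :
    inner 𝕜 (besselHankel α f l) (besselHankel α g l) =
      ∫ z : ℝ × ℝ, inner 𝕜 (besselEven α (l * z.2) • f z.2) (besselEven α (l * z.1) • g z.1)
        ∂halfLine.prod halfLine := by
  simp only [RCLike.inner_apply, besselHankel, kernelOp]
  rw [← integral_conj, ← integral_prod_mul]

lemma integrable_exp_smul_inner_besselHankel (hα : -1 / 2 ≤ α) (ht : 0 < t)
    (hf : MemL2Ioo R f) (hg : MemL2Ioo R g) :
    Integrable (fun l => Real.exp (-t * l ^ 2) • inner 𝕜 (besselHankel α f l) (besselHankel α g l))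
      halfLine := by
  simp_rw [inner_besselHankel_eq_integral, ← integral_smul]
  exact (integrable_exp_smul_inner_besselEven_smul hα ht hf hg).integral_prod_left

lemma inner_heatL2_toLp (hα : -1 / 2 ≤ α) (ht : 0 < t) (hf : MemLp f 2 halfLine)
    (hg : MemLp g 2 halfLine) :
    inner 𝕜 (heatL2 𝕜 hα t (hf.toLp f)) (hg.toLp g) =
      ∫ z : ℝ × ℝ, besselHeatKernel α t z.1 z.2 • inner 𝕜 (f z.2) (g z.1)
        ∂halfLine.prod halfLine := by
  have hα1 : -1 < α := by linarith
  obtain ⟨c, -, hk⟩ := exists_isSchurKernel_besselHeatKernel hα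
  rw [integral_prod _ ((hk t ht).integrable_smul_inner hf hg), L2.inner_def]
  refine integral_congr_ae ?_
  filter_upwards [coeFn_heatL2_toLp hα ht.le hf, besselSemigroup_ae_eq hα1 ht f,
    hg.coeFn_toLp] with x hheat hkernel hgx
  rw [hheat, hkernel, hgx, inner_kernelOp_left]

theorem integral_exp_smul_inner_besselHankel (hα : -1 / 2 ≤ α) (ht : 0 < t)
    (hf : MemL2Ioo R f) (hg : MemL2Ioo R g) :
    ∫ l, Real.exp (-t * l ^ 2) • inner 𝕜 (besselHankel α f l) (besselHankel α g l) ∂halfLine =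
      inner 𝕜 (heatL2 𝕜 hα t (hf.memLp.toLp f)) (hg.memLp.toLp g) := by
  have hα1 : -1 < α := by linarith
  simp_rw [inner_besselHankel_eq_integral, ← integral_smul]
  rw [integral_integral_swap (integrable_exp_smul_inner_besselEven_smul hα ht hf hg),
    inner_heatL2_toLp hα ht]
  refine integral_congr_ae (Eventually.of_forall fun z => ?_)
  by_cases hz : z.1 ∈ Ioo 0 R ∧ z.2 ∈ Ioo 0 R
  · beta_reduce
    rw [← integral_exp_mul_besselEven_mul_besselEven hα1 ht hz.1.1 hz.2.1, ← integral_smul_const]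
    refine integral_congr_ae (Eventually.of_forall fun l => ?_)
    simp only [RCLike.inner_apply, RCLike.real_smul_eq_coe_mul, map_mul, RCLike.conj_ofReal]
    ring
  · rcases not_and_or.1 hz with hz | hz
    · simp [hg.eq_zero _ hz]
    · simp [hf.eq_zero _ hz]

lemma lintegral_exp_mul_enorm_besselHankel_sq (hα : -1 / 2 ≤ α) (ht : 0 < t)
    (hf : MemL2Ioo R f) :
    ∫⁻ l, ENNReal.ofReal (Real.exp (-t * l ^ 2)) * ‖besselHankel α f l‖ₑ ^ 2 ∂halfLine =
      ‖inner 𝕜 (heatL2 𝕜 hα t (hf.memLp.toLp f)) (hf.memLp.toLp f)‖ₑ := by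
  have hself (l : ℝ) : Real.exp (-t * l ^ 2) • inner 𝕜 (besselHankel α f l) (besselHankel α f l) =
      ((Real.exp (-t * l ^ 2) * ‖besselHankel α f l‖ ^ 2 : ℝ) : 𝕜) := by
    rw [inner_self_eq_norm_sq_to_K, RCLike.real_smul_eq_coe_mul, RCLike.ofReal_mul,
      RCLike.ofReal_pow]
  have hint := integrable_exp_smul_inner_besselHankel hα ht hf hf
  simp_rw [hself] at hint
  have hnonneg (l : ℝ) : 0 ≤ Real.exp (-t * l ^ 2) * ‖besselHankel α f l‖ ^ 2 := by positivity
  have hint_re : Integrable (fun l => Real.exp (-t * l ^ 2) * ‖besselHankel α f l‖ ^ 2)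
      halfLine := by
    simpa only [RCLike.ofReal_re] using hint.re
  rw [← integral_exp_smul_inner_besselHankel hα ht hf hf]
  simp_rw [hself]
  rw [integral_ofReal, ← ofReal_norm, RCLike.norm_ofReal, abs_of_nonneg (integral_nonneg hnonneg),
    ofReal_integral_eq_lintegral_ofReal hint_re (Eventually.of_forall hnonneg)]
  refine lintegral_congr fun l => ?_
  rw [ENNReal.ofReal_mul (Real.exp_pos _).le, ENNReal.ofReal_pow (norm_nonneg _), ofReal_norm]

theorem memLp_besselHankel (hα : -1 / 2 ≤ α) (hf : MemL2Ioo R f) :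
    MemLp (besselHankel α f) 2 halfLine := by
  obtain ⟨c, hc⟩ := exists_norm_heatL2_le (𝕜 := 𝕜) hα
  have hmeas := aestronglyMeasurable_besselHankel hα hf.memLp.1
  have hbound : ∫⁻ l, ‖besselHankel α f l‖ₑ ^ 2 ∂halfLine ≤
      ENNReal.ofReal (c * ‖hf.memLp.toLp f‖ * ‖hf.memLp.toLp f‖) := by
    refine lintegral_le_of_forall_lintegral_exp_neg_mul_sq_mul_le (hmeas.enorm.pow_const 2)
      fun t ht => ?_
    rw [lintegral_exp_mul_enorm_besselHankel_sq hα ht hf, ← ofReal_norm]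
    refine ENNReal.ofReal_le_ofReal ((norm_inner_le_norm _ _).trans ?_)
    gcongr
    exact hc t _
  refine ⟨hmeas, ?_⟩
  rw [eLpNorm_lt_top_iff_lintegral_rpow_enorm_lt_top two_ne_zero ENNReal.ofNat_ne_top]
  simpa using hbound.trans_lt ENNReal.ofReal_lt_top

end BoundedSupport

section InnerProduct

variable {X 𝕜 : Type*} [MeasurableSpace X] [RCLike 𝕜] {μ : Measure X} {f g : X → 𝕜}

lemma inner_toLp_toLp (hf : MemLp f 2 μ) (hg : MemLp g 2 μ) :
    inner 𝕜 (hf.toLp f) (hg.toLp g) = ∫ x, inner 𝕜 (f x) (g x) ∂μ := by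
  rw [L2.inner_def]
  refine integral_congr_ae ?_
  filter_upwards [hf.coeFn_toLp, hg.coeFn_toLp] with x hfx hgx
  rw [hfx, hgx]

lemma integrable_inner_of_memLp_two (hf : MemLp f 2 μ) (hg : MemLp g 2 μ) :
    Integrable (fun x => inner 𝕜 (f x) (g x)) μ :=
  (hf.norm.integrable_mul hg.norm).mono' (hf.1.inner hg.1)
    (Eventually.of_forall fun _ => norm_inner_le_norm _ _)

end InnerProduct

namespace MemL2Ioo

variable {α t R S : ℝ} {𝕜 : Type*} [RCLike 𝕜] {f g : ℝ → 𝕜}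

/-- The Hankel transform of a function with bounded support, as an element of `L²(0, ∞)`. -/
def hankelL2 (hα : -1 / 2 ≤ α) (hf : MemL2Ioo R f) : Lp 𝕜 2 halfLine :=
  (memLp_besselHankel hα hf).toLp (besselHankel α f)

theorem inner_hankelL2 (hα : -1 / 2 ≤ α) (hf : MemL2Ioo R f) (hg : MemL2Ioo R g) :
    inner 𝕜 (hf.hankelL2 hα) (hg.hankelL2 hα) =
      inner 𝕜 (hf.memLp.toLp f) (hg.memLp.toLp g) := by
  have hheat := (tendsto_heatL2 hα (hf.memLp.toLp f)).inner (𝕜 := 𝕜)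
    (tendsto_const_nhds (x := hg.memLp.toLp g))
  have hint : Integrable (fun l => inner 𝕜 (besselHankel α f l) (besselHankel α g l)) halfLine :=
    integrable_inner_of_memLp_two (memLp_besselHankel hα hf) (memLp_besselHankel hα hg)
  rw [hankelL2, hankelL2, inner_toLp_toLp]
  refine tendsto_nhds_unique (tendsto_integral_exp_neg_mul_sq_smul hint) (hheat.congr' ?_)
  filter_upwards [self_mem_nhdsWithin] with t ht
  exact (integral_exp_smul_inner_besselHankel hα ht hf hg).symm

lemma norm_hankelL2 (hα : -1 / 2 ≤ α) (hf : MemL2Ioo R f) :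
    ‖hf.hankelL2 hα‖ = ‖hf.memLp.toLp f‖ := by
  rw [← sq_eq_sq₀ (norm_nonneg _) (norm_nonneg _), ← inner_self_eq_norm_sq (𝕜 := 𝕜),
    ← inner_self_eq_norm_sq (𝕜 := 𝕜), inner_hankelL2 hα hf hf]

theorem dist_hankelL2 (hα : -1 / 2 ≤ α) (hf : MemL2Ioo R f) (hg : MemL2Ioo S g) :
    dist (hf.hankelL2 hα) (hg.hankelL2 hα) = dist (hf.memLp.toLp f) (hg.memLp.toLp g) := by
  have hfg := (hf.mono (le_max_left R S)).sub (hg.mono (le_max_right R S))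
  have hsub : hf.hankelL2 hα - hg.hankelL2 hα = hfg.hankelL2 hα := by
    rw [hankelL2, hankelL2, ← MemLp.toLp_sub]
    exact MemLp.toLp_congr _ _ (besselHankel_sub hα hf hg).symm
  rw [dist_eq_norm, dist_eq_norm, hsub, norm_hankelL2, MemLp.toLp_sub]

lemma exists_abs_besselEven_mul_le (hα : -1 / 2 ≤ α) (R : ℝ) :
    ∃ C, ∀ x ∈ Ioo 0 R, ∀ y ∈ Ioo 0 R, |besselEven α (x * y)| ≤ C := by
  obtain ⟨C, hC⟩ := (isCompact_Icc (a := 0) (b := R ^ 2)).exists_bound_of_continuousOn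
    (continuous_besselEven hα).continuousOn
  refine ⟨C, fun x hx y hy => hC _ ⟨(mul_pos hx.1 hy.1).le, ?_⟩⟩
  rw [sq]
  exact mul_le_mul hx.2.le hy.2.le hy.1.le (hx.1.trans hx.2).le

lemma integrable_besselEven_mul_smul_inner (hα : -1 / 2 ≤ α) (hf : MemL2Ioo R f)
    (hg : MemL2Ioo R g) :
    Integrable (fun q : ℝ × ℝ => besselEven α (q.1 * q.2) • inner 𝕜 (f q.2) (g q.1))
      (halfLine.prod halfLine) := by
  obtain ⟨C, hC⟩ := exists_abs_besselEven_mul_le hα R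
  refine ((hg.integrable.norm.mul_prod hf.integrable.norm).const_mul C).mono'
    ((measurable_besselEven_mul hα).aestronglyMeasurable.smul
      (hf.memLp.1.comp_snd.inner hg.memLp.1.comp_fst)) (Eventually.of_forall fun ⟨x, y⟩ => ?_)
  by_cases hx : x ∈ Ioo 0 R
  · by_cases hy : y ∈ Ioo 0 R
    · rw [norm_smul, Real.norm_eq_abs]
      refine mul_le_mul (hC x hx y hy) ?_ (norm_nonneg _) ((abs_nonneg _).trans (hC x hx y hy))
      exact (norm_inner_le_norm _ _).trans_eq (mul_comm _ _)
    · simp [hf.eq_zero y hy]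
  · simp [hg.eq_zero x hx]

theorem inner_hankelL2_left (hα : -1 / 2 ≤ α) (hf : MemL2Ioo R f) (hg : MemL2Ioo R g) :
    inner 𝕜 (hf.hankelL2 hα) (hg.memLp.toLp g) =
      inner 𝕜 (hf.memLp.toLp f) (hg.hankelL2 hα) := by
  rw [hankelL2, hankelL2, inner_toLp_toLp, inner_toLp_toLp]
  exact integral_inner_kernelOp (fun x y => by rw [mul_comm])
    (integrable_besselEven_mul_smul_inner hα hf hg)

end MemL2Ioo

/-! ### The Hankel transform on `L²(0, ∞)` -/

section Truncation

variable {α : ℝ} {𝕜 : Type*} [RCLike 𝕜] {f : ℝ → 𝕜}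

lemma memL2Ioo_indicator (hf : MemLp f 2 halfLine) (R : ℝ) :
    MemL2Ioo R ((Ioo 0 R).indicator f) :=
  ⟨hf.indicator measurableSet_Ioo, fun _ hx => indicator_of_notMem hx f⟩

theorem tendsto_eLpNorm_indicator_Ioo_sub {E : Type*} [NormedAddCommGroup E] {f : ℝ → E}
    {p : ℝ≥0∞} (hp : p ≠ 0) (hp_top : p ≠ ∞) (hf : MemLp f p halfLine) :
    Tendsto (fun R => eLpNorm ((Ioo 0 R).indicator f - f) p halfLine) atTop (𝓝 0) := by
  have hp_pos := ENNReal.toReal_pos hp hp_top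
  have hpow : Tendsto (fun R => ∫⁻ x, ‖((Ioo 0 R).indicator f - f) x‖ₑ ^ p.toReal ∂halfLine) atTop
      (𝓝 (∫⁻ _, 0 ∂halfLine)) := by
    refine tendsto_lintegral_filter_of_dominated_convergence' (fun x => ‖f x‖ₑ ^ p.toReal)
      (Eventually.of_forall fun R =>
        ((hf.1.indicator measurableSet_Ioo).sub hf.1).enorm.pow_const _)
      (Eventually.of_forall fun R => Eventually.of_forall fun x => ?_)
      (lintegral_rpow_enorm_lt_top_of_eLpNorm_lt_top hp hp_top hf.2).ne ?_
    · by_cases hx : x ∈ Ioo 0 R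
      · simp [hx, hp_pos]
      · simp [hx]
    · filter_upwards [ae_halfLine_pos] with x hx
      refine tendsto_const_nhds.congr' ?_
      filter_upwards [eventually_gt_atTop x] with R hR
      simp [show x ∈ Ioo 0 R from ⟨hx, hR⟩, hp_pos]
  simp_rw [eLpNorm_eq_lintegral_rpow_enorm_toReal hp hp_top]
  refine ((ENNReal.continuous_rpow_const (y := 1 / p.toReal)).tendsto' 0 0 ?_).comp
    (by simpa only [lintegral_zero] using hpow)
  exact ENNReal.zero_rpow_of_pos (by positivity)

lemma tendsto_toLp_indicator_Ioo (hf : MemLp f 2 halfLine) :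
    Tendsto (fun R => (memL2Ioo_indicator hf R).memLp.toLp ((Ioo 0 R).indicator f)) atTop
      (𝓝 (hf.toLp f)) :=
  (Lp.tendsto_Lp_iff_tendsto_eLpNorm'' _ _ _ _).2
    (tendsto_eLpNorm_indicator_Ioo_sub two_ne_zero ENNReal.ofNat_ne_top hf)

lemma besselHankel_indicator_Ioo (f : ℝ → 𝕜) (R : ℝ) {l : ℝ} (hl : 0 < l) :
    besselHankel α ((Ioo 0 R).indicator f) l = ∫ x in Ioo 0 R, besselPsi α l x • f x := by
  have hsmul (x : ℝ) : besselEven α (l * x) • (Ioo 0 R).indicator f x =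
      (Ioo 0 R).indicator (fun x => besselEven α (l * x) • f x) x :=
    (indicator_smul_apply (Ioo 0 R) (fun x => besselEven α (l * x)) f x).symm
  simp only [besselHankel, kernelOp, hsmul, halfLine]
  rw [setIntegral_indicator measurableSet_Ioo, inter_eq_right.2 Ioo_subset_Ioi_self]
  refine setIntegral_congr_fun measurableSet_Ioo fun x hx => ?_
  rw [besselPsi_eq_besselEven hl hx.1]

end Truncation

section Hankel

variable {α t : ℝ} {𝕜 : Type*} [RCLike 𝕜] {f g f' g' : ℝ → 𝕜}

theorem isHankelTransform_iff_tendsto (hα : -1 / 2 ≤ α) (hf : MemLp f 2 halfLine)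
    (hg : MemLp g 2 halfLine) :
    IsHankelTransform α f g ↔
      Tendsto (fun R => (memL2Ioo_indicator hf R).hankelL2 hα) atTop (𝓝 (hg.toLp g)) := by
  unfold MemL2Ioo.hankelL2
  rw [Lp.tendsto_Lp_iff_tendsto_eLpNorm'', IsHankelTransform, and_iff_right hg]
  refine tendsto_congr fun R => ?_
  rw [eLpNorm_sub_comm]
  refine eLpNorm_congr_ae ?_
  filter_upwards [ae_halfLine_pos] with l hl
  rw [Pi.sub_apply, besselHankel_indicator_Ioo f R hl]

theorem exists_isHankelTransform (hα : -1 / 2 ≤ α) (hf : MemLp f 2 halfLine) :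
    ∃ g : ℝ → 𝕜, IsHankelTransform α f g := by
  have hcauchy := (tendsto_toLp_indicator_Ioo hf).cauchySeq
  have hcauchy_hankel : CauchySeq fun R => (memL2Ioo_indicator hf R).hankelL2 hα := by
    rw [Metric.cauchySeq_iff] at hcauchy ⊢
    simpa only [MemL2Ioo.dist_hankelL2] using hcauchy
  obtain ⟨u, hu⟩ := cauchySeq_tendsto_of_complete hcauchy_hankel
  refine ⟨u, (isHankelTransform_iff_tendsto hα hf (Lp.memLp u)).2 ?_⟩
  rwa [Lp.toLp_coeFn]

lemma IsHankelTransform.memLp (h : IsHankelTransform α f g) : MemLp g 2 halfLine :=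
  h.1

lemma IsHankelTransform.congr_right (h : IsHankelTransform α f g) (hg : g =ᵐ[halfLine] g') :
    IsHankelTransform α f g' := by
  refine ⟨(memLp_congr_ae hg).1 h.1, h.2.congr fun R => eLpNorm_congr_ae ?_⟩
  filter_upwards [hg] with l hl
  rw [hl]

theorem IsHankelTransform.inner_toLp_left (hα : -1 / 2 ≤ α) (hf : MemLp f 2 halfLine)
    (hf' : MemLp f' 2 halfLine) (h : IsHankelTransform α f g) (h' : IsHankelTransform α f' g') :
    inner 𝕜 (h.memLp.toLp g) (hf'.toLp f') = inner 𝕜 (hf.toLp f) (h'.memLp.toLp g') := by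
  have hleft := ((isHankelTransform_iff_tendsto hα hf h.memLp).1 h).inner (𝕜 := 𝕜)
    (tendsto_toLp_indicator_Ioo hf')
  have hright := (tendsto_toLp_indicator_Ioo hf).inner (𝕜 := 𝕜)
    ((isHankelTransform_iff_tendsto hα hf' h'.memLp).1 h')
  exact tendsto_nhds_unique (hleft.congr fun R => MemL2Ioo.inner_hankelL2_left hα _ _) hright

lemma memLp_top_exp_neg_mul_sq (ht : 0 ≤ t) :
    MemLp (fun l => Real.exp (-t * l ^ 2)) ∞ halfLine :=
  memLp_top_of_bound (by fun_prop : Measurable fun l : ℝ =>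
    Real.exp (-t * l ^ 2)).aestronglyMeasurable 1
    (Eventually.of_forall (norm_exp_neg_mul_sq_le_one ht))

lemma memLp_exp_neg_mul_sq_smul (ht : 0 ≤ t) (hf : MemLp f 2 halfLine) :
    MemLp (fun l => Real.exp (-t * l ^ 2) • f l) 2 halfLine :=
  hf.smul (memLp_top_exp_neg_mul_sq ht)

/-- Multiplication by `l ↦ exp (-t l²)` on `L²(0, ∞)`: the heat operator of order `α` on the
Hankel transform side. -/
def expMulL2 (𝕜 : Type*) [RCLike 𝕜] (ht : 0 ≤ t) : Lp 𝕜 2 halfLine →L[ℝ] Lp 𝕜 2 halfLine :=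
  (ContinuousLinearMap.lsmul ℝ ℝ).holderL halfLine ∞ 2 2 ((memLp_top_exp_neg_mul_sq ht).toLp _)

lemma expMulL2_toLp (ht : 0 ≤ t) (hf : MemLp f 2 halfLine) :
    expMulL2 𝕜 ht (hf.toLp f) = (memLp_exp_neg_mul_sq_smul ht hf).toLp _ := by
  refine Lp.ext ((ContinuousLinearMap.coeFn_holder _ _ _).trans ?_)
  filter_upwards [(memLp_top_exp_neg_mul_sq ht).coeFn_toLp, hf.coeFn_toLp,
    (memLp_exp_neg_mul_sq_smul ht hf).coeFn_toLp] with l hexp hfl hsmul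
  rw [hexp, hfl, hsmul, ContinuousLinearMap.lsmul_apply]

theorem MemL2Ioo.inner_expMulL2_hankelL2 {R : ℝ} (hα : -1 / 2 ≤ α) (ht : 0 ≤ t)
    (hf : MemL2Ioo R f) (hg : MemL2Ioo R g) :
    inner 𝕜 (expMulL2 𝕜 ht (hf.hankelL2 hα)) (hg.hankelL2 hα) =
      inner 𝕜 (heatL2 𝕜 hα t (hf.memLp.toLp f)) (hg.memLp.toLp g) := by
  rcases ht.eq_or_lt with rfl | ht'
  · have hexp : expMulL2 𝕜 ht (hf.hankelL2 hα) = hf.hankelL2 hα := by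
      rw [hankelL2, expMulL2_toLp]
      simp only [neg_zero, zero_mul, Real.exp_zero, one_smul]
    rw [hexp, inner_hankelL2, heatL2, dif_neg (lt_irrefl _), ContinuousLinearMap.id_apply]
  · rw [← integral_exp_smul_inner_besselHankel hα ht' hf hg, hankelL2, hankelL2, expMulL2_toLp,
      inner_toLp_toLp]
    simp only [inner_smul_left_eq_smul]

theorem IsHankelTransform.inner_expMulL2 (hα : -1 / 2 ≤ α) (ht : 0 ≤ t) (hf : MemLp f 2 halfLine)
    (hf' : MemLp f' 2 halfLine) (h : IsHankelTransform α f g) (h' : IsHankelTransform α f' g') :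
    inner 𝕜 (expMulL2 𝕜 ht (h.memLp.toLp g)) (h'.memLp.toLp g') =
      inner 𝕜 (heatL2 𝕜 hα t (hf.toLp f)) (hf'.toLp f') := by
  have hmul := ((expMulL2 𝕜 ht).continuous.tendsto _).comp
    ((isHankelTransform_iff_tendsto hα hf h.memLp).1 h)
  have hheat := ((heatL2 𝕜 hα t).continuous.tendsto _).comp (tendsto_toLp_indicator_Ioo hf)
  have hleft := hmul.inner (𝕜 := 𝕜) ((isHankelTransform_iff_tendsto hα hf' h'.memLp).1 h')
  have hright := hheat.inner (𝕜 := 𝕜) (tendsto_toLp_indicator_Ioo hf')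
  exact tendsto_nhds_unique (hleft.congr fun R => MemL2Ioo.inner_expMulL2_hankelL2 hα ht _ _)
    hright

theorem isHankelHeat_besselSemigroup (hα : -1 / 2 ≤ α) (ht : 0 ≤ t) (hf : MemLp f 2 halfLine) :
    IsHankelHeat α t f (besselSemigroup α t f) := by
  obtain ⟨g, hg⟩ := exists_isHankelTransform hα hf
  have hexp := memLp_exp_neg_mul_sq_smul ht hg.memLp
  obtain ⟨h, hh⟩ := exists_isHankelTransform hα hexp
  refine ⟨g, hg, hh.congr_right ?_⟩
  have hheat : hh.memLp.toLp h = heatL2 𝕜 hα t (hf.toLp f) := by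
    refine ext_inner_right 𝕜 fun v => ?_
    obtain ⟨g', hg'⟩ := exists_isHankelTransform hα (Lp.memLp v)
    have hcomm := hh.inner_toLp_left hα hexp (Lp.memLp v) hg'
    have hmul := hg.inner_expMulL2 hα ht hf (Lp.memLp v) hg'
    rw [Lp.toLp_coeFn] at hcomm hmul
    rw [hcomm, ← hmul, expMulL2_toLp]
  exact hh.memLp.coeFn_toLp.symm.trans (hheat ▸ coeFn_heatL2_toLp hα ht hf)

end Hankel

/-! ### Contractivity, positivity and conservativity -/

section Semigroup

variable {α t : ℝ} {𝕜 : Type*} [RCLike 𝕜] {f g : ℝ → 𝕜}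

lemma aestronglyMeasurable_besselSemigroup (hα : -1 < α) (ht : 0 ≤ t)
    (hf : AEStronglyMeasurable f halfLine) :
    AEStronglyMeasurable (besselSemigroup α t f) halfLine := by
  rcases ht.eq_or_lt with rfl | ht
  · rwa [besselSemigroup_zero]
  · exact (aestronglyMeasurable_kernelOp (measurable_besselHeatKernel hα t) hf).congr
      (besselSemigroup_ae_eq hα ht f).symm

lemma besselSemigroup_add (hα : -1 / 2 ≤ α) (ht : 0 ≤ t) (hf : MemL1AddLinfty halfLine f)
    (hg : MemL1AddLinfty halfLine g) :
    besselSemigroup α t (f + g) =ᵐ[halfLine] besselSemigroup α t f + besselSemigroup α t g := by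
  rcases ht.eq_or_lt with rfl | ht
  · simp only [besselSemigroup_zero, EventuallyEq.refl]
  · have hα1 : -1 < α := by linarith
    obtain ⟨c, -, hk⟩ := exists_isSchurKernel_besselHeatKernel hα
    exact (besselSemigroup_ae_eq hα1 ht _).trans (((hk t ht).kernelOp_add_ae hf hg).trans
      ((besselSemigroup_ae_eq hα1 ht f).add (besselSemigroup_ae_eq hα1 ht g)).symm)

lemma besselSemigroup_smul (α t : ℝ) (a : 𝕜) (f : ℝ → 𝕜) :
    besselSemigroup α t (a • f) = a • besselSemigroup α t f := by
  unfold besselSemigroup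
  split_ifs
  · rfl
  · exact kernelOp_smul (k := besselKernel α t) a f

theorem besselSemigroup_nonneg (hα : -1 < α) (ht : 0 ≤ t) (hf : ∀ᵐ x ∂halfLine, 0 ≤ f x) :
    ∀ᵐ x ∂halfLine, 0 ≤ besselSemigroup α t f x := by
  rcases ht.eq_or_lt with rfl | ht
  · rwa [besselSemigroup_zero]
  · filter_upwards [besselSemigroup_ae_eq hα ht f] with x hx
    rw [hx]
    exact kernelOp_nonneg (besselHeatKernel_nonneg hα ht) hf x

theorem integral_inner_besselSemigroup (hα : -1 / 2 ≤ α) (ht : 0 ≤ t) (hf : MemLp f 2 halfLine)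
    (hg : MemLp g 2 halfLine) :
    ∫ x, inner 𝕜 (besselSemigroup α t f x) (g x) ∂halfLine =
      ∫ x, inner 𝕜 (f x) (besselSemigroup α t g x) ∂halfLine := by
  rcases ht.eq_or_lt with rfl | ht
  · simp only [besselSemigroup_zero]
  · have hα1 : -1 < α := by linarith
    obtain ⟨c, -, hk⟩ := exists_isSchurKernel_besselHeatKernel hα
    refine (integral_congr_ae ?_).trans
      (((hk t ht).integral_inner_kernelOp hf hg).trans (integral_congr_ae ?_))
    · filter_upwards [besselSemigroup_ae_eq hα1 ht f] with x hx
      rw [hx]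
    · filter_upwards [besselSemigroup_ae_eq hα1 ht g] with x hx
      rw [hx]

theorem isSymmetricDiffusionSemigroup_besselSemigroup (hα : -1 / 2 ≤ α)
    (hle : ∀ u, 0 < u → auxH (α / 2 + 3 / 4) (α + 1) u ≤ 1) :
    IsSymmetricDiffusionSemigroup halfLine (besselSemigroup (𝕜 := 𝕜) α) where
  measurable _ ht _ hf :=
    aestronglyMeasurable_besselSemigroup (by linarith) ht hf.aestronglyMeasurable
  congr _ _ _ _ _ _ h := besselSemigroup_congr_ae h
  map_add _ ht _ _ hf hg := besselSemigroup_add hα ht hf hg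
  map_smul t _ a f _ := .of_eq (besselSemigroup_smul α t a f)
  map_zero_time f _ := .of_eq (besselSemigroup_zero α f)
  contraction t ht p hp f hf := by
    rcases ht.eq_or_lt with rfl | ht
    · rw [besselSemigroup_zero]
      exact ⟨hf, le_rfl⟩
    · simpa only [ENNReal.ofReal_one, one_mul] using
        memLp_besselSemigroup (show -1 < α by linarith) hle ht hp hf
  semigroup _ _ hs ht _ hp _ hf := besselSemigroup_add_time hα hs ht (.of_memLp hp hf)
  self_adjoint _ ht _ _ hf hg := integral_inner_besselSemigroup hα ht hf hg
  tendsto_zero _ hf := tendsto_eLpNorm_besselSemigroup hα hf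

theorem isSubmarkovianSemigroup_besselSemigroup (hα : -1 / 2 ≤ α)
    (hle : ∀ u, 0 < u → auxH (α / 2 + 3 / 4) (α + 1) u ≤ 1) :
    IsSubmarkovianSemigroup halfLine (besselSemigroup (𝕜 := 𝕜) α) where
  toIsSymmetricDiffusionSemigroup := isSymmetricDiffusionSemigroup_besselSemigroup hα hle
  positive _ ht _ _ h := besselSemigroup_nonneg (by linarith) ht h
  subconservative t ht := by
    rcases ht.eq_or_lt with rfl | ht
    · rw [besselSemigroup_zero]
      exact Eventually.of_forall fun _ => le_rfl
    · filter_upwards [ae_halfLine_pos] with x hx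
      rw [besselSemigroup_one (by linarith) ht hx, ← RCLike.ofReal_one (K := 𝕜),
        RCLike.ofReal_le_ofReal]
      exact hle _ (by positivity)

theorem isMarkovianSemigroup_besselSemigroup_neg_half :
    IsMarkovianSemigroup halfLine (besselSemigroup (𝕜 := 𝕜) (-1 / 2)) where
  toIsSymmetricDiffusionSemigroup := isSymmetricDiffusionSemigroup_besselSemigroup le_rfl
    fun u _ => (auxH_bessel_neg_half u).le
  positive _ ht _ _ h := besselSemigroup_nonneg (by norm_num) ht h
  conservative t ht := by
    rcases ht.eq_or_lt with rfl | ht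
    · rw [besselSemigroup_zero]
      exact Eventually.of_forall fun _ => rfl
    · filter_upwards [ae_halfLine_pos] with x hx
      rw [besselSemigroup_one (by norm_num) ht hx, auxH_bessel_neg_half, RCLike.ofReal_one]

theorem not_isMarkovianSemigroup_besselSemigroup (hα : 1 / 2 ≤ α) :
    ¬ IsMarkovianSemigroup halfLine (besselSemigroup (𝕜 := 𝕜) α) := by
  intro h
  have : NeZero halfLine := ⟨by simp [halfLine, Measure.restrict_eq_zero]⟩
  obtain ⟨x, hx, hone⟩ := (ae_halfLine_pos.and (h.conservative 1 zero_le_one)).exists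
  rw [besselSemigroup_one (by linarith) one_pos hx, ← RCLike.ofReal_one (K := 𝕜),
    RCLike.ofReal_inj] at hone
  exact (auxH_bessel_lt_one hα (by positivity)).ne hone

end Semigroup

section NotContractive

variable {α : ℝ} {𝕜 : Type*} [RCLike 𝕜]

theorem not_isLpContractive_besselSemigroup (hα : -1 / 2 < α) (hα' : α < 1 / 2) :
    ¬ IsLpContractive halfLine (besselSemigroup (𝕜 := 𝕜) α) := by
  intro hcontr
  have hα1 : -1 < α := by linarith
  obtain ⟨u₀, hu₀⟩ := exists_one_lt_auxH_bessel hα hα'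
  set s : Set ℝ := Ioo (2 * √u₀) (2 * √u₀ + 1)
  have hs : MeasurableSet s := measurableSet_Ioo
  have hs_pos : s ⊆ Ioi 0 := fun y hy => lt_of_le_of_lt (by positivity) hy.1
  have hμs : halfLine s = 1 := by
    rw [halfLine, Measure.restrict_apply hs, inter_eq_left.2 hs_pos, Real.volume_Ioo,
      add_sub_cancel_left, ENNReal.ofReal_one]
  have hmemLp (p : ℝ≥0∞) : MemLp (s.indicator fun _ => (1 : 𝕜)) p halfLine :=
    memLp_indicator_const p hs 1 (Or.inr (hμs ▸ ENNReal.one_ne_top))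
  have hint : ∀ᵐ x ∂halfLine, IntegrableOn (besselHeatKernel α 1 x) s halfLine := by
    filter_upwards [ae_halfLine_pos] with x hx
    have hrow := integrable_besselHeatKernel_smul (𝕜 := ℝ) hα.le one_pos
      (.of_memLp le_top (memLp_top_const 1)) hx
    simpa only [smul_eq_mul, mul_one] using hrow.integrableOn
  have hrow (y : ℝ) (hy : y ∈ s) : 1 < ∫⁻ x, ‖besselHeatKernel α 1 y x‖ₑ ∂halfLine := by
    rw [lintegral_enorm_besselHeatKernel hα1 one_pos (hs_pos hy), ENNReal.one_lt_ofReal]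
    refine hu₀ _ ?_
    have hsqrt : √u₀ < y / 2 := by linarith [hy.1]
    linarith [Real.lt_sq_of_sqrt_lt hsqrt]
  refine (hcontr 1 le_rfl 1 zero_le_one _ (hmemLp 2) (hmemLp 1)).not_gt ?_
  rw [eLpNorm_congr_ae (besselSemigroup_ae_eq hα1 one_pos _)]
  exact eLpNorm_one_indicator_lt_kernelOp (measurable_besselHeatKernel hα1 1)
    (besselHeatKernel_comm α 1) (besselHeatKernel_nonneg hα1 one_pos) hs (by simp [hμs])
    (by simp [hμs]) hint hrow

end NotContractive

end

theorem mainTheorem8 {𝕜 : Type*} [RCLike 𝕜] (α : ℝ) (hα : -1 / 2 ≤ α) :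
    -- the integral operators are defined on `L¹ + L^∞`, at every point
    (∀ t : ℝ, 0 < t → ∀ f : ℝ → 𝕜, MemL1AddLinfty halfLine f → ∀ x : ℝ, 0 < x →
      Integrable (fun y => besselKernel α t x y • f y) halfLine) ∧
    -- and on `L²` they are the heat semigroup defined through the Hankel transform
    (∀ t : ℝ, 0 ≤ t → ∀ f : ℝ → 𝕜, MemLp f 2 halfLine →
      IsHankelHeat α t f (besselSemigroup α t f)) ∧
    -- the value on the constant function one
    (∀ t : ℝ, 0 < t → ∀ x : ℝ, 0 < x →
      besselSemigroup α t (fun _ => (1 : 𝕜)) x =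
        ((auxH (α / 2 + 3 / 4) (α + 1) (x ^ 2 / (4 * t)) : ℝ) : 𝕜)) ∧
    ((α = -1 / 2 ∨ 1 / 2 ≤ α) →
      IsSubmarkovianSemigroup halfLine (besselSemigroup (𝕜 := 𝕜) α) ∧
      (IsMarkovianSemigroup halfLine (besselSemigroup (𝕜 := 𝕜) α) ↔ α = -1 / 2)) ∧
    ((-1 / 2 < α ∧ α < 1 / 2) →
      ¬ IsLpContractive halfLine (besselSemigroup (𝕜 := 𝕜) α) ∧
      ∃ c : ℝ, 1 < c ∧ ∀ p : ℝ≥0∞, 1 ≤ p → ∀ t : ℝ, 0 < t → ∀ f : ℝ → 𝕜,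
        MemLp f p halfLine →
        MemLp (besselSemigroup α t f) p halfLine ∧
        eLpNorm (besselSemigroup α t f) p halfLine ≤
          ENNReal.ofReal c * eLpNorm f p halfLine) := by
  have hα1 : -1 < α := by linarith
  refine ⟨fun t ht f hf x hx => integrable_besselKernel_smul hα ht hf hx,
    fun t ht f hf => isHankelHeat_besselSemigroup hα ht hf,
    fun t ht x hx => besselSemigroup_one hα1 ht hx, fun h => ?_, fun h => ?_⟩
  · rcases h with rfl | h
    · exact ⟨isSubmarkovianSemigroup_besselSemigroup le_rfl fun u _ => (auxH_bessel_neg_half u).le,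
        iff_of_true isMarkovianSemigroup_besselSemigroup_neg_half rfl⟩
    · exact ⟨isSubmarkovianSemigroup_besselSemigroup hα fun _ hu => (auxH_bessel_lt_one h hu).le,
        iff_of_false (not_isMarkovianSemigroup_besselSemigroup h) (by linarith)⟩
  · obtain ⟨c, hc1, hc⟩ := exists_auxH_bessel_le hα
    exact ⟨not_isLpContractive_besselSemigroup h.1 h.2, c, hc1, fun p hp t ht f hf =>
      memLp_besselSemigroup hα1 hc ht hp hf⟩
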